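/- Let $d\ge 1$, $m\ge 1$, and let $A$ be a $d\times d$ integer matrix that is an isotropic dilation matrix: its complex eigenvalues all have the same absolute value, which is greater than $1$, and $A$ is diagonalizable over $\mathbb C$. Put $q=|\det A|$ and let $Q$ be a real symmetric positive definite matrix such that $A^{-T}=q^{-1/d}\,Q^{-1}UQ$ for some orthogonal matrix $U$. With $Q^2=(q_{ij})$ define $$P(\xi)=\xi^TQ^2\xi,\qquad G(\xi)=4\sum_{i}q_{ii}\sin^2\tfrac{\xi_i}{2}+2\sum_{i<j}q_{ij}\sin\xi_i\sin\xi_j ,$$ $$m_0(\xi)=\prod_{s\in S\setminus\{0\}}\frac{G(\xi+2\pi s)}{G(2\pi s)},\qquad S=\{s\in[0,1)^d: A^Ts\in\mathbb Z^d\},$$ $$\mu(\xi)=\frac{q^{2/d}\,m_0(A^{-T}\xi)\,G(A^{-T}\xi)}{G(\xi)},\qquad M(\xi)=\prod_{j\ge 0}\mu\big((A^{-T})^j\xi\big),$$ where $\mu$ takes the value $1$ on $2\pi\mathbb Z^d$ (the value of its continuous extension). Let $\hat f(\xi)=\int f(x)e^{-i\xi\cdot x}\,dx$, extended to tempered distributions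 by duality. For a function $f$ locally integrable on $\mathbb R^d\setminus\{0\}$ and a tempered distribution $u$ we write $\hat u=f$ if $\langle\hat u,\eta\rangle=\int f\eta$ for every Schwartz function $\eta$ for which the integral converges absolutely (so $\hat u$ is a regularization of $f$ at the origin if $f$ is not integrable there). For tempered distributions $u,v$ we write $v=(\Delta^\sharp)^mu$ if $\hat u=f$ and $\hat v=(P/M)^mf$ for some such function $f$; that is, $\Delta^\sharp$ is the operator with symbol $P/M$. The elliptic scaling function $\phi^m$ of order $m$ is the tempered distribution with $$\widehat{\phi^m}(\xi)=\Big(\prod_{j\ge1}m_0\big((A^{-T})^j\xi\big)\Big)^m .$$ **Proposition.** The tempered distribution $\phi^m$ exists and is unique. There is a tempered distribution $\rho$ with $\hat\rho=(M/P)^m$, and every such $\rho$ is a Green function of $(\Delta^\sharp)^m$, i.e. $(\Delta^\sharp)^m\rho=\delta$. There are finitely many nonzero coefficients $c_k\in\mathbb C$, $k\in\mathbb Z^d$, such that for every such $\rho$ $$\phi^m=\sum_{k}c_k\,\rho(\cdot-k).$$ Moreover, $(\Delta^\sharp)^m\phi^m$ is a well-defined (unique) tempered distribution, and $$(\Delta^\sharp)^m\phi^m=0\quad\text{on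 }\mathbb R^d\setminus\mathbb Z^d$$ in the sense of distributions. -/

import Mathlib

open MeasureTheory
open scoped SchwartzMap

namespace EllipticScaling

noncomputable section

/-! ### Matrices -/

/-- `A` is a dilation matrix: all its complex eigenvalues are greater than `1` in absolute value. -/
def IsDilation {d : ℕ} (A : Matrix (Fin d) (Fin d) ℤ) : Prop :=
  ∀ z ∈ spectrum ℂ (A.map (Int.cast : ℤ → ℂ)), 1 < ‖z‖

/-- `A` is isotropic: diagonalizable over `ℂ`, with all eigenvalues equal in absolute value. -/
def IsIsotropic {d : ℕ} (A : Matrix (Fin d) (Fin d) ℤ) : Prop :=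
  (∃ (S : Matrix (Fin d) (Fin d) ℂ) (D : Fin d → ℂ), IsUnit S.det ∧
    A.map (Int.cast : ℤ → ℂ) = S * Matrix.diagonal D * S⁻¹) ∧
  ∀ z ∈ spectrum ℂ (A.map (Int.cast : ℤ → ℂ)),
    ∀ w ∈ spectrum ℂ (A.map (Int.cast : ℤ → ℂ)), ‖z‖ = ‖w‖

/-- The matrix `A` with real entries. -/
def realMat {d : ℕ} (A : Matrix (Fin d) (Fin d) ℤ) : Matrix (Fin d) (Fin d) ℝ :=
  A.map (Int.cast : ℤ → ℝ)

/-- `A^{-T}`. -/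
def invT {d : ℕ} (A : Matrix (Fin d) (Fin d) ℤ) : Matrix (Fin d) (Fin d) ℝ :=
  ((realMat A).transpose)⁻¹

/-- `q = |det A|`. -/
def absDet {d : ℕ} (A : Matrix (Fin d) (Fin d) ℤ) : ℝ := |(realMat A).det|

/-- `A^{-T} = q^{-1/d} Q⁻¹ U Q` with `Q` symmetric positive definite and `U` orthogonal. -/
def IsSimilarityFactor {d : ℕ} (A : Matrix (Fin d) (Fin d) ℤ)
    (Q : Matrix (Fin d) (Fin d) ℝ) : Prop :=
  Q.PosDef ∧ ∃ U ∈ Matrix.orthogonalGroup (Fin d) ℝ,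
    invT A = ((absDet A) ^ (1 / (d : ℝ)))⁻¹ • (Q⁻¹ * U * Q)

/-! ### The functions `P`, `G`, `m₀`, `μ`, `M`, and the Fourier transform of `φ` -/

/-- The quadratic form `P(x) = xᵀ Q² x`. -/
def P {d : ℕ} (Q : Matrix (Fin d) (Fin d) ℝ) (x : Fin d → ℝ) : ℝ :=
  x ⬝ᵥ ((Q ^ 2).mulVec x)

/-- The trigonometric polynomial
`G(ξ) = 4 ∑ᵢ qᵢᵢ sin²(ξᵢ/2) + 2 ∑_{i<j} qᵢⱼ sin ξᵢ sin ξⱼ`, where `Q² = (qᵢⱼ)`. -/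
def G {d : ℕ} (Q : Matrix (Fin d) (Fin d) ℝ) (ξ : Fin d → ℝ) : ℝ :=
  4 * ∑ i, (Q ^ 2) i i * Real.sin (ξ i / 2) ^ 2 +
    2 * ∑ i, ∑ j ∈ Finset.Ioi i, (Q ^ 2) i j * (Real.sin (ξ i) * Real.sin (ξ j))

/-- The points `s ∈ [0,1)^d` with `Aᵀ s ∈ ℤ^d`. -/
def digitPts {d : ℕ} (A : Matrix (Fin d) (Fin d) ℤ) : Set (Fin d → ℝ) :=
  {s | (∀ i, 0 ≤ s i ∧ s i < 1) ∧
    ∃ n : Fin d → ℤ, (realMat A).transpose.mulVec s = fun i => (n i : ℝ)}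

/-- The mask `m₀`.  The products are finite, as the set of digits of a nonsingular matrix is. -/
def mask {d : ℕ} (A : Matrix (Fin d) (Fin d) ℤ) (Q : Matrix (Fin d) (Fin d) ℝ)
    (ξ : Fin d → ℝ) : ℝ :=
  (∏ᶠ s ∈ digitPts A \ {0}, G Q (ξ + (2 * Real.pi) • s)) /
    ∏ᶠ s ∈ digitPts A \ {0}, G Q ((2 * Real.pi) • s)

/-- `φ̂(ξ) = ∏_{j ≥ 1} m₀((A^{-T})^j ξ)`. -/
def phiHat {d : ℕ} (A : Matrix (Fin d) (Fin d) ℤ) (Q : Matrix (Fin d) (Fin d) ℝ)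
    (ξ : Fin d → ℝ) : ℝ :=
  ∏' j : ℕ, mask A Q ((invT A ^ (j + 1)).mulVec ξ)

open Classical in
/-- `μ(ξ) = q^{2/d} m₀(A^{-T}ξ) G(A^{-T}ξ) / G(ξ)`; at the zeros of `G`, that is on `2πℤ^d`,
where the quotient is `0/0`, it takes the value `1` of its continuous extension. -/
def mu {d : ℕ} (A : Matrix (Fin d) (Fin d) ℤ) (Q : Matrix (Fin d) (Fin d) ℝ)
    (ξ : Fin d → ℝ) : ℝ :=
  if G Q ξ = 0 then 1
  else absDet A ^ (2 / (d : ℝ)) * mask A Q ((invT A).mulVec ξ) * G Q ((invT A).mulVec ξ) / G Q ξ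

/-- `M(ξ) = ∏_{j ≥ 0} μ((A^{-T})^j ξ)`. -/
def M {d : ℕ} (A : Matrix (Fin d) (Fin d) ℤ) (Q : Matrix (Fin d) (Fin d) ℝ)
    (ξ : Fin d → ℝ) : ℝ :=
  ∏' j : ℕ, mu A Q ((invT A ^ j).mulVec ξ)

/-! ### Tempered distributions -/

/-- Multiplication by `(2π)⁻¹` as a linear homeomorphism. -/
def scale (d : ℕ) : EuclideanSpace ℝ (Fin d) ≃L[ℝ] EuclideanSpace ℝ (Fin d) :=
  ContinuousLinearEquiv.smulLeft (Units.mk0 ((2 * Real.pi)⁻¹ : ℝ) (by positivity))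

/-- The Fourier transform `η ↦ ∫ e^{-i x·ξ} η(ξ) dξ` on Schwartz functions
(Mathlib's transform has `e^{-2πi x·ξ}`). -/
def fourierS (d : ℕ) :
    𝓢(EuclideanSpace ℝ (Fin d), ℂ) →L[ℂ] 𝓢(EuclideanSpace ℝ (Fin d), ℂ) :=
  (SchwartzMap.compCLMOfContinuousLinearEquiv ℂ (scale d)).comp
    (FourierTransform.fourierCLM ℂ 𝓢(EuclideanSpace ℝ (Fin d), ℂ))

theorem fourierS_apply {d : ℕ} (η : 𝓢(EuclideanSpace ℝ (Fin d), ℂ))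
    (x : EuclideanSpace ℝ (Fin d)) :
    fourierS d η x = ∫ ξ, Complex.exp (-Complex.I * (inner ℝ x ξ : ℝ)) * η ξ := by
  have h : fourierS d η x = FourierTransform.fourier (η : EuclideanSpace ℝ (Fin d) → ℂ)
      (((2 * Real.pi)⁻¹ : ℝ) • x) := by
    rw [← SchwartzMap.fourier_coe]
    rfl
  rw [h, Real.fourier_eq']
  refine integral_congr_ae (Filter.Eventually.of_forall fun ξ => ?_)
  have hpi : (Real.pi : ℂ) ≠ 0 := by exact_mod_cast Real.pi_ne_zero
  simp only [smul_eq_mul, inner_smul_right]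
  rw [real_inner_comm]
  congr 2
  push_cast
  field_simp

/-- The Fourier transform of a tempered distribution, `⟨û, η⟩ = ⟨u, η̂⟩`. -/
def fourierT {d : ℕ} (u : 𝓢'(EuclideanSpace ℝ (Fin d), ℂ)) :
    𝓢'(EuclideanSpace ℝ (Fin d), ℂ) :=
  PointwiseConvergenceCLM.precomp ℂ (fourierS d) u

/-- The shift `u(· - a)` of a tempered distribution, `⟨u(· - a), η⟩ = ⟨u, η(· + a)⟩`. -/
def shift {d : ℕ} (a : EuclideanSpace ℝ (Fin d)) (u : 𝓢'(EuclideanSpace ℝ (Fin d), ℂ)) :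
    𝓢'(EuclideanSpace ℝ (Fin d), ℂ) :=
  PointwiseConvergenceCLM.precomp ℂ (SchwartzMap.compSubConstCLM ℂ (-a)) u

/-- The point `k ∈ ℤ^d` of `ℝ^d`. -/
def latticePt {d : ℕ} (k : Fin d → ℤ) : EuclideanSpace ℝ (Fin d) :=
  WithLp.toLp 2 fun i => (k i : ℝ)

/-- The Fourier transform of `u` is the function `f`, which may have a non-integrable singularity
at the origin: `⟨û, η⟩ = ∫ f η` for every Schwartz function `η` for which the integral converges
absolutely.  If `f` is locally integrable on the whole space and of polynomial growth, that is for
all `η`, and `û` is the distribution given by `f`; otherwise `û` is a regularization of `f`. -/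
def HasFourierTransform {d : ℕ} (u : 𝓢'(EuclideanSpace ℝ (Fin d), ℂ))
    (f : EuclideanSpace ℝ (Fin d) → ℂ) : Prop :=
  LocallyIntegrableOn f {0}ᶜ volume ∧
  ∀ η : 𝓢(EuclideanSpace ℝ (Fin d), ℂ), Integrable (fun ξ => f ξ * η ξ) →
    fourierT u η = ∫ ξ, f ξ * η ξ

/-- `v` is the image of `u` under the operator with symbol `σ`:  `û = f` and `v̂ = σ f`. -/
def IsImageUnderSymbol {d : ℕ} (σ : EuclideanSpace ℝ (Fin d) → ℂ)
    (u v : 𝓢'(EuclideanSpace ℝ (Fin d), ℂ)) : Prop :=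
  ∃ f : EuclideanSpace ℝ (Fin d) → ℂ,
    HasFourierTransform u f ∧ HasFourierTransform v (fun ξ => σ ξ * f ξ)

/-! ### Elliptic scaling functions, the operator `Δ♯`, the Green function -/

/-- `φ` is the elliptic scaling function `φ^m` of order `m`: its Fourier transform is `φ̂^m`. -/
def IsEllipticScalingFunction {d : ℕ} (A : Matrix (Fin d) (Fin d) ℤ)
    (Q : Matrix (Fin d) (Fin d) ℝ) (m : ℕ) (φ : 𝓢'(EuclideanSpace ℝ (Fin d), ℂ)) : Prop :=
  HasFourierTransform φ (fun ξ => ((phiHat A Q ξ.ofLp : ℝ) : ℂ) ^ m)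

/-- The symbol `P / M` of the operator `Δ♯`. -/
def deltaSharpSymbol {d : ℕ} (A : Matrix (Fin d) (Fin d) ℤ) (Q : Matrix (Fin d) (Fin d) ℝ)
    (ξ : EuclideanSpace ℝ (Fin d)) : ℂ :=
  ((P Q ξ.ofLp / M A Q ξ.ofLp : ℝ) : ℂ)

/-- `v = (Δ♯)^m u`. -/
def IsDeltaSharpPow {d : ℕ} (A : Matrix (Fin d) (Fin d) ℤ) (Q : Matrix (Fin d) (Fin d) ℝ)
    (m : ℕ) (u v : 𝓢'(EuclideanSpace ℝ (Fin d), ℂ)) : Prop :=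
  IsImageUnderSymbol (fun ξ => deltaSharpSymbol A Q ξ ^ m) u v

/-- `ρ` is a Green function: its Fourier transform is `(M / P)^m`. -/
def IsGreenFunction {d : ℕ} (A : Matrix (Fin d) (Fin d) ℤ) (Q : Matrix (Fin d) (Fin d) ℝ)
    (m : ℕ) (ρ : 𝓢'(EuclideanSpace ℝ (Fin d), ℂ)) : Prop :=
  HasFourierTransform ρ (fun ξ => ((M A Q ξ.ofLp / P Q ξ.ofLp : ℝ) : ℂ) ^ m)

end

end EllipticScaling

open EllipticScaling

/-! Write B = A^{-T} and r = q^{-1/d}. Everything rests on the identity φ̂ = (M/P)·G off 2πℤ^d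
(`phiHat_eq`). It comes from telescoping: by the definition of μ, the product of μ(B^j ξ) over j <
n, times G(ξ), equals the product of m₀(B^{j+1} ξ) over j < n, times q^{2n/d} G(B^n ξ). Since P(Bξ)
= r² P(ξ) and G = P + O(P^{3/2}), the last factor tends to P(ξ).

Now G^m is a trigonometric polynomial ∑ c_k e^{-ik·ξ}. Multiplication by e^{-ik·ξ} on the Fourier
side is the shift by k, so φ̂^m = (M/P)^m G^m says that φ^m is the combination of shifts of ρ with
coefficients c_k. Similarly (P/M)^m φ̂^m = G^m almost everywhere, so (Δ♯)^m φ^m = ∑ c_k δ_k, which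
lives on ℤ^d.

The analysis has two parts. The product M must converge to a positive function of polynomial growth:
μ is bounded (`exists_mu_le`), μ − 1 = O(√P) (`exists_abs_mu_sub_one_le`), and √P shrinks by the
factor r under B (`exists_M_le`). Moreover (M/P)^m has a singularity of order 2m at 0 and needs a
regularization (`exists_regularization`). The choice of regularization does not affect φ^m, because
G^m cancels the singularity. -/

namespace EllipticScaling

open Finset

/-! ### Quadratic forms -/

/-- The sum of the squares of the coordinates. -/
noncomputable def sqNorm {d : ℕ} (x : Fin d → ℝ) : ℝ := ∑ i, x i ^ 2

theorem sqNorm_nonneg {d : ℕ} (x : Fin d → ℝ) : 0 ≤ sqNorm x :=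
  sum_nonneg fun _ _ => sq_nonneg _

theorem sq_le_sqNorm {d : ℕ} (x : Fin d → ℝ) (i : Fin d) : x i ^ 2 ≤ sqNorm x :=
  single_le_sum (f := fun i => x i ^ 2) (fun _ _ => sq_nonneg _) (mem_univ i)

theorem sqNorm_eq_zero {d : ℕ} {x : Fin d → ℝ} : sqNorm x = 0 ↔ x = 0 := by
  rw [sqNorm, sum_eq_zero_iff_of_nonneg fun _ _ => sq_nonneg _]
  simp [funext_iff]

theorem sqNorm_eq_dotProduct {d : ℕ} (x : Fin d → ℝ) : sqNorm x = x ⬝ᵥ x := by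
  simp [sqNorm, dotProduct, sq]

theorem sqNorm_ofLp {d : ℕ} (x : EuclideanSpace ℝ (Fin d)) : sqNorm x.ofLp = ‖x‖ ^ 2 := by
  rw [EuclideanSpace.norm_sq_eq]
  simp [sqNorm]

theorem exists_sqNorm_mulVec_le {d : ℕ} (T : Matrix (Fin d) (Fin d) ℝ) :
    ∃ K, 0 < K ∧ ∀ x, sqNorm (T.mulVec x) ≤ K * sqNorm x := by
  refine ⟨1 + ∑ i, ∑ j, T i j ^ 2, by positivity, fun x => ?_⟩
  have h : sqNorm (T.mulVec x) ≤ (∑ i, ∑ j, T i j ^ 2) * sqNorm x := by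
    rw [sum_mul]
    exact sum_le_sum fun i _ => sum_mul_sq_le_sq_mul_sq univ (T i) x
  linarith [sqNorm_nonneg x]

theorem sqNorm_mulVec_of_mem_orthogonalGroup {d : ℕ} {U : Matrix (Fin d) (Fin d) ℝ}
    (hU : U ∈ Matrix.orthogonalGroup (Fin d) ℝ) (x : Fin d → ℝ) :
    sqNorm (U.mulVec x) = sqNorm x := by
  rw [sqNorm_eq_dotProduct, sqNorm_eq_dotProduct, Matrix.dotProduct_mulVec,
    Matrix.vecMul_mulVec]
  have h : U.transpose * U = 1 := by
    have := (Matrix.mem_orthogonalGroup_iff' (Fin d) ℝ).1 hU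
    simpa [Matrix.star_eq_conjTranspose] using this
  simp [h]

variable {d : ℕ} {Q : Matrix (Fin d) (Fin d) ℝ}

theorem transpose_eq_of_posDef (hQ : Q.PosDef) : Q.transpose = Q := by
  simpa using hQ.isHermitian.eq

theorem P_eq_sqNorm (hQ : Q.PosDef) (x : Fin d → ℝ) : P Q x = sqNorm (Q.mulVec x) := by
  rw [P, sqNorm_eq_dotProduct, Matrix.dotProduct_mulVec, Matrix.dotProduct_mulVec,
    Matrix.vecMul_mulVec, transpose_eq_of_posDef hQ, sq]

theorem exists_P_le (hQ : Q.PosDef) : ∃ K, 0 < K ∧ ∀ x, P Q x ≤ K * sqNorm x := by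
  obtain ⟨K, hK, h⟩ := exists_sqNorm_mulVec_le Q
  exact ⟨K, hK, fun x => by rw [P_eq_sqNorm hQ]; exact h x⟩

theorem exists_le_P (hQ : Q.PosDef) : ∃ k, 0 < k ∧ ∀ x, k * sqNorm x ≤ P Q x := by
  obtain ⟨K, hK, h⟩ := exists_sqNorm_mulVec_le Q⁻¹
  refine ⟨K⁻¹, inv_pos.2 hK, fun x => ?_⟩
  have := h (Q.mulVec x)
  rw [Matrix.mulVec_mulVec, Matrix.nonsing_inv_mul _ hQ.det_pos.ne'.isUnit,
    Matrix.one_mulVec, ← P_eq_sqNorm hQ] at this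
  rw [inv_mul_le_iff₀ hK]
  exact this

theorem P_nonneg (hQ : Q.PosDef) (x : Fin d → ℝ) : 0 ≤ P Q x := by
  rw [P_eq_sqNorm hQ]
  exact sqNorm_nonneg _

theorem P_zero : P Q 0 = 0 := by simp [P]

theorem P_eq_zero (hQ : Q.PosDef) {x : Fin d → ℝ} : P Q x = 0 ↔ x = 0 := by
  refine ⟨fun h => ?_, fun h => by rw [h, P_zero]⟩
  obtain ⟨k, hk, hP⟩ := exists_le_P hQ
  have := hP x
  rw [h] at this
  exact sqNorm_eq_zero.1 (le_antisymm (nonpos_of_mul_nonpos_right this hk) (sqNorm_nonneg x))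

theorem P_single (i : Fin d) : P Q (Pi.single i 1) = (Q ^ 2) i i := by
  simp [P]

theorem sqNorm_single (i : Fin d) : sqNorm (Pi.single i (1 : ℝ)) = 1 := by
  simp [sqNorm, Pi.single_apply]

theorem P_eq_sum (hQ : Q.PosDef) (x : Fin d → ℝ) :
    P Q x = ∑ i, (Q ^ 2) i i * x i ^ 2 +
      2 * ∑ i, ∑ j ∈ Ioi i, (Q ^ 2) i j * (x i * x j) := by
  have hsymm : ∀ i j, (Q ^ 2) i j = (Q ^ 2) j i := fun i j => by
    conv_lhs => rw [← transpose_eq_of_posDef hQ, ← Matrix.transpose_pow]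
    rfl
  have h := sum_sum_Ioi_add_eq_sum_sum_off_diag (fun i j : Fin d => (Q ^ 2) j i * (x j * x i))
  have h2 : 2 * ∑ i, ∑ j ∈ Ioi i, (Q ^ 2) i j * (x i * x j) =
      ∑ i, ∑ j ∈ Ioi i, ((Q ^ 2) i j * (x i * x j) + (Q ^ 2) j i * (x j * x i)) := by
    rw [mul_sum]
    refine sum_congr rfl fun i _ => ?_
    rw [mul_sum]
    refine sum_congr rfl fun j _ => ?_
    rw [hsymm j i]
    ring
  rw [h2, h, ← sum_add_distrib, P, dotProduct]
  refine sum_congr rfl fun i _ => ?_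
  rw [Matrix.mulVec, dotProduct, mul_sum, Fintype.sum_eq_add_sum_compl i]
  congr 1
  · ring
  · exact sum_congr rfl fun j _ => by ring

/-! ### The trigonometric polynomial `G` -/

/-- From 4 sin²(x/2) = sin² x + 4 sin⁴(x/2). This makes the positivity of G visible, as P ≥ 0 and Q²
has a nonnegative diagonal. -/
theorem G_eq_P_sin_add (hQ : Q.PosDef) (ξ : Fin d → ℝ) :
    G Q ξ = P Q (fun i => Real.sin (ξ i)) + 4 * ∑ i, (Q ^ 2) i i * Real.sin (ξ i / 2) ^ 4 := by
  rw [P_eq_sum hQ, G, mul_sum univ _ (4 : ℝ), mul_sum univ _ (4 : ℝ), add_right_comm,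
    ← sum_add_distrib]
  congr 1
  refine sum_congr rfl fun i _ => ?_
  have h1 : Real.sin (ξ i) = 2 * Real.sin (ξ i / 2) * Real.cos (ξ i / 2) := by
    rw [← Real.sin_two_mul]; ring_nf
  have h2 := Real.sin_sq_add_cos_sq (ξ i / 2)
  rw [h1, show (2 * Real.sin (ξ i / 2) * Real.cos (ξ i / 2)) ^ 2 =
    4 * Real.sin (ξ i / 2) ^ 2 * Real.cos (ξ i / 2) ^ 2 by ring, ← sub_eq_iff_eq_add'.2 h2.symm]
  ring

/-- `4 ∑ sin² (ξᵢ / 2)`. -/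
noncomputable def sinSq (ξ : Fin d → ℝ) : ℝ := 4 * sqNorm fun i => Real.sin (ξ i / 2)

/-- The identity of `G_eq_P_sin_add` for Q = 1. -/
theorem sqNorm_sin_add (ξ : Fin d → ℝ) :
    sqNorm (fun i => Real.sin (ξ i)) + 4 * ∑ i, Real.sin (ξ i / 2) ^ 4 = sinSq ξ := by
  rw [sinSq, sqNorm, sqNorm, mul_sum, mul_sum, ← sum_add_distrib]
  refine sum_congr rfl fun i _ => ?_
  have h1 : Real.sin (ξ i) = 2 * Real.sin (ξ i / 2) * Real.cos (ξ i / 2) := by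
    rw [← Real.sin_two_mul]; ring_nf
  have h2 := Real.sin_sq_add_cos_sq (ξ i / 2)
  rw [h1]
  linear_combination 4 * Real.sin (ξ i / 2) ^ 2 * h2

/-- The bound k|x|² ≤ P(x) is used at the vector of sines and at the unit vectors, where P gives the
diagonal entries of Q². With `exists_G_le` it makes G comparable to `sinSq`, uniformly in ξ. -/
theorem exists_le_G (hQ : Q.PosDef) : ∃ k, 0 < k ∧ ∀ ξ, k * sinSq ξ ≤ G Q ξ := by
  obtain ⟨k, hk, hP⟩ := exists_le_P hQ
  refine ⟨k, hk, fun ξ => ?_⟩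
  rw [G_eq_P_sin_add hQ, ← sqNorm_sin_add, mul_add, mul_left_comm k 4, mul_sum univ _ k]
  refine add_le_add (hP _) (mul_le_mul_of_nonneg_left (sum_le_sum fun i _ => ?_) (by norm_num))
  have := hP (Pi.single i 1)
  rw [P_single, sqNorm_single, mul_one] at this
  exact mul_le_mul_of_nonneg_right this (by positivity)

theorem exists_G_le (hQ : Q.PosDef) : ∃ K, 0 < K ∧ ∀ ξ, G Q ξ ≤ K * sinSq ξ := by
  obtain ⟨K, hK, hP⟩ := exists_P_le hQ
  refine ⟨K, hK, fun ξ => ?_⟩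
  rw [G_eq_P_sin_add hQ, ← sqNorm_sin_add, mul_add, mul_left_comm K 4, mul_sum univ _ K]
  refine add_le_add (hP _) (mul_le_mul_of_nonneg_left (sum_le_sum fun i _ => ?_) (by norm_num))
  have := hP (Pi.single i 1)
  rw [P_single, sqNorm_single, mul_one] at this
  exact mul_le_mul_of_nonneg_right this (Even.pow_nonneg (by decide) _)

theorem sinSq_nonneg (ξ : Fin d → ℝ) : 0 ≤ sinSq ξ := mul_nonneg (by norm_num) (sqNorm_nonneg _)

theorem sinSq_le_sqNorm (ξ : Fin d → ℝ) : sinSq ξ ≤ sqNorm ξ := by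
  rw [sinSq, sqNorm, sqNorm, mul_sum]
  refine sum_le_sum fun i _ => ?_
  have h := sq_le_sq.2 (Real.abs_sin_le_abs (x := ξ i / 2))
  linarith [show (ξ i / 2) ^ 2 = ξ i ^ 2 / 4 by ring]

theorem sinSq_le (ξ : Fin d → ℝ) : sinSq ξ ≤ 4 * d := by
  rw [sinSq, sqNorm]
  have : ∑ i, Real.sin (ξ i / 2) ^ 2 ≤ ∑ _i : Fin d, (1 : ℝ) :=
    sum_le_sum fun i _ => Real.sin_sq_le_one _
  simp at this
  linarith

theorem le_sinSq {ξ : Fin d → ℝ} (h : ∀ i, |ξ i| ≤ Real.pi) :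
    4 / Real.pi ^ 2 * sqNorm ξ ≤ sinSq ξ := by
  rw [sinSq, sqNorm, sqNorm, mul_sum, mul_sum]
  refine sum_le_sum fun i _ => ?_
  have h1 := Real.mul_abs_le_abs_sin (x := ξ i / 2)
    (by rw [abs_div, abs_two]; linarith [h i])
  have h2 := pow_le_pow_left₀ (by positivity) h1 2
  rw [sq_abs, mul_pow, sq_abs] at h2
  linarith [show 4 / Real.pi ^ 2 * ξ i ^ 2 = 4 * ((2 / Real.pi) ^ 2 * (ξ i / 2) ^ 2) by ring]

theorem G_nonneg (hQ : Q.PosDef) (ξ : Fin d → ℝ) : 0 ≤ G Q ξ := by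
  obtain ⟨k, hk, h⟩ := exists_le_G hQ
  exact (mul_nonneg hk.le (sinSq_nonneg ξ)).trans (h ξ)

theorem G_add_lattice (ξ : Fin d → ℝ) (n : Fin d → ℤ) :
    G Q (ξ + (2 * Real.pi) • fun i => (n i : ℝ)) = G Q ξ := by
  have h1 : ∀ i, Real.sin ((ξ + (2 * Real.pi) • fun i => (n i : ℝ)) i) = Real.sin (ξ i) :=
    fun i => by
      rw [← Real.sin_add_int_mul_two_pi (ξ i) (n i)]
      congr 1
      simp; ring
  have h2 : ∀ i, Real.sin ((ξ + (2 * Real.pi) • fun i => (n i : ℝ)) i / 2) ^ 2 =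
      Real.sin (ξ i / 2) ^ 2 := fun i => by
    rw [show (ξ + (2 * Real.pi) • fun i => (n i : ℝ)) i / 2 = ξ i / 2 + n i * Real.pi by
      simp; ring, Real.sin_add_int_mul_pi, mul_pow]
    rcases Int.even_or_odd (n i) with h | h <;> simp [h.neg_one_zpow]
  simp only [G, h1, h2]

theorem G_eq_zero_iff (hQ : Q.PosDef) {ξ : Fin d → ℝ} :
    G Q ξ = 0 ↔ ∃ n : Fin d → ℤ, ξ = (2 * Real.pi) • fun i => (n i : ℝ) := by
  constructor
  · intro h
    obtain ⟨k, hk, hG⟩ := exists_le_G hQ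
    have h1 := hG ξ
    rw [h] at h1
    have h2 : sinSq ξ = 0 := le_antisymm (nonpos_of_mul_nonpos_right h1 hk) (sinSq_nonneg ξ)
    rw [sinSq, mul_eq_zero_iff_left (by norm_num), sqNorm_eq_zero] at h2
    have h3 : ∀ i, ∃ n : ℤ, (n : ℝ) * Real.pi = ξ i / 2 := fun i =>
      Real.sin_eq_zero_iff.1 (congrFun h2 i)
    choose n hn using h3
    refine ⟨n, funext fun i => ?_⟩
    simp only [Pi.smul_apply, smul_eq_mul]
    linarith [hn i]
  · rintro ⟨n, rfl⟩
    rw [← zero_add ((2 * Real.pi) • fun i => (n i : ℝ)), G_add_lattice]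
    simp [G]

theorem exists_G_le_P (hQ : Q.PosDef) : ∃ K, 0 < K ∧ ∀ ξ, G Q ξ ≤ K * P Q ξ := by
  obtain ⟨K, hK, h⟩ := exists_G_le hQ
  obtain ⟨k, hk, h'⟩ := exists_le_P hQ
  refine ⟨K * k⁻¹, by positivity, fun ξ => ?_⟩
  calc G Q ξ ≤ K * sinSq ξ := h ξ
    _ ≤ K * (k⁻¹ * P Q ξ) := by
      refine mul_le_mul_of_nonneg_left ?_ hK.le
      rw [le_inv_mul_iff₀ hk]
      exact (mul_le_mul_of_nonneg_left (sinSq_le_sqNorm ξ) hk.le).trans (h' ξ)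
    _ = _ := by ring

theorem exists_G_le_const (hQ : Q.PosDef) : ∃ K, 0 < K ∧ ∀ ξ, G Q ξ ≤ K := by
  obtain ⟨K, hK, h⟩ := exists_G_le hQ
  -- The summand 1 keeps the constant positive when d = 0.
  exact ⟨K * (4 * d) + 1, by positivity, fun ξ =>
    ((h ξ).trans (mul_le_mul_of_nonneg_left (sinSq_le ξ) hK.le)).trans (by linarith)⟩

/-- Jordan's inequality, hence the restriction to the period cube: G also vanishes at the other
points of 2πℤ^d, where P does not. -/
theorem exists_P_le_G (hQ : Q.PosDef) :
    ∃ K, 0 < K ∧ ∀ ξ : Fin d → ℝ, (∀ i, |ξ i| ≤ Real.pi) → P Q ξ ≤ K * G Q ξ := by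
  obtain ⟨k, hk, h⟩ := exists_le_G hQ
  obtain ⟨K, hK, h'⟩ := exists_P_le hQ
  refine ⟨K * (Real.pi ^ 2 / 4) * k⁻¹, by positivity, fun ξ hξ => ?_⟩
  have h1 : sinSq ξ ≤ k⁻¹ * G Q ξ := by
    rw [le_inv_mul_iff₀ hk]
    exact h ξ
  have h2 : sqNorm ξ ≤ Real.pi ^ 2 / 4 * sinSq ξ := by
    have := mul_le_mul_of_nonneg_left (le_sinSq hξ) (show 0 ≤ Real.pi ^ 2 / 4 by positivity)
    rwa [← mul_assoc, div_mul_div_comm, mul_comm (4 : ℝ), div_self (by positivity), one_mul] at this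
  calc P Q ξ ≤ K * sqNorm ξ := h' ξ
    _ ≤ K * (Real.pi ^ 2 / 4 * (k⁻¹ * G Q ξ)) :=
      mul_le_mul_of_nonneg_left (h2.trans (mul_le_mul_of_nonneg_left h1 (by positivity))) hK.le
    _ = _ := by ring

theorem abs_sin_sub_self_le (x : ℝ) : |Real.sin x - x| ≤ 2 * x ^ 2 := by
  rcases le_or_gt |x| 1 with h | h
  · have h1 := Real.sin_bound h
    have h2 : Real.sin x - x = (Real.sin x - (x - x ^ 3 / 6)) - x ^ 3 / 6 := by ring
    rw [h2]
    refine (abs_sub _ _).trans ?_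
    have h3 : |x ^ 3 / 6| = |x| ^ 3 / 6 := by rw [abs_div, abs_pow]; norm_num
    rw [h3, ← sq_abs x]
    have h4 : |x| ^ 3 ≤ |x| ^ 2 := pow_le_pow_of_le_one (abs_nonneg _) h (by norm_num)
    have h5 : |x| ^ 5 ≤ |x| ^ 2 := pow_le_pow_of_le_one (abs_nonneg _) h (by norm_num)
    have := sq_nonneg |x|
    linarith
  · refine (abs_sub _ _).trans ?_
    have := Real.abs_sin_le_abs (x := x)
    rw [← sq_abs x]
    nlinarith

/-- One order beyond the quadratic term is all that is needed. With u = (sin ξᵢ), P(u) − P(ξ) = ⟨Q(u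
− ξ), Q(u + ξ)⟩, and by Cauchy–Schwarz the crude bound |sin x − x| ≤ 2x² gives a product of orders 2
and 1. The quartic remainder is cubic because |sin| ≤ 1. -/
theorem exists_abs_G_sub_P_le (hQ : Q.PosDef) :
    ∃ C, 0 ≤ C ∧ ∀ ξ, |G Q ξ - P Q ξ| ≤ C * √(P Q ξ) ^ 3 := by
  obtain ⟨K, hK, h⟩ := exists_P_le hQ
  obtain ⟨k, hk, h'⟩ := exists_le_P hQ
  have key : ∀ ξ, |G Q ξ - P Q ξ| ≤ (4 * K + d * K) * √(sqNorm ξ) ^ 3 := fun ξ => by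
    set s := √(sqNorm ξ) with hs
    have hs0 : 0 ≤ s := Real.sqrt_nonneg _
    have hs2 : s ^ 2 = sqNorm ξ := Real.sq_sqrt (sqNorm_nonneg ξ)
    have hξ : ∀ i, |ξ i| ≤ s := fun i => Real.abs_le_sqrt (sq_le_sqNorm ξ i)
    set u : Fin d → ℝ := fun i => Real.sin (ξ i) with hu
    have h1 : |P Q u - P Q ξ| ≤ 4 * K * s ^ 3 := by
      have e : P Q u - P Q ξ =
          ∑ i, (Q.mulVec (u - ξ)) i * (Q.mulVec (u + ξ)) i := by
        rw [P_eq_sqNorm hQ, P_eq_sqNorm hQ, sqNorm, sqNorm, ← sum_sub_distrib]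
        refine sum_congr rfl fun i _ => ?_
        rw [Matrix.mulVec_sub, Matrix.mulVec_add, Pi.sub_apply, Pi.add_apply]
        ring
      have e1 : sqNorm (u - ξ) ≤ 4 * s ^ 4 := by
        have : sqNorm (u - ξ) ≤ ∑ i, 4 * s ^ 2 * ξ i ^ 2 := sum_le_sum fun i _ => by
          have h2 := pow_le_pow_left₀ (abs_nonneg _) (abs_sin_sub_self_le (ξ i)) 2
          rw [sq_abs] at h2
          have h3 : ξ i ^ 2 ≤ s ^ 2 := hs2 ▸ sq_le_sqNorm ξ i
          have h4 := mul_le_mul_of_nonneg_right h3 (sq_nonneg (ξ i))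
          simp only [hu, Pi.sub_apply]
          nlinarith
        rw [← mul_sum, show ∑ i, ξ i ^ 2 = s ^ 2 from hs2.symm] at this
        linarith [show 4 * s ^ 2 * s ^ 2 = 4 * s ^ 4 by ring]
      have e2 : sqNorm (u + ξ) ≤ 4 * s ^ 2 := by
        rw [hs2, sqNorm, sqNorm, mul_sum]
        refine sum_le_sum fun i _ => ?_
        have := sq_le_sq.2 (Real.abs_sin_le_abs (x := ξ i))
        simp only [hu, Pi.add_apply]
        nlinarith [sq_nonneg (Real.sin (ξ i) - ξ i)]
      rw [e]
      refine abs_le_of_sq_le_sq ?_ (by positivity)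
      refine (sum_mul_sq_le_sq_mul_sq _ _ _).trans ?_
      have f1 : sqNorm (Q.mulVec (u - ξ)) ≤ K * (4 * s ^ 4) := by
        rw [← P_eq_sqNorm hQ]
        exact (h _).trans (mul_le_mul_of_nonneg_left e1 hK.le)
      have f2 : sqNorm (Q.mulVec (u + ξ)) ≤ K * (4 * s ^ 2) := by
        rw [← P_eq_sqNorm hQ]
        exact (h _).trans (mul_le_mul_of_nonneg_left e2 hK.le)
      refine (mul_le_mul f1 f2 (sqNorm_nonneg _) (by positivity)).trans (le_of_eq ?_)
      ring
    have h2 : |4 * ∑ i, (Q ^ 2) i i * Real.sin (ξ i / 2) ^ 4| ≤ d * K * s ^ 3 := by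
      rw [abs_mul, abs_of_pos (show (0 : ℝ) < 4 by norm_num)]
      have : |∑ i, (Q ^ 2) i i * Real.sin (ξ i / 2) ^ 4| ≤ ∑ _i : Fin d, K * (s ^ 3 / 8) := by
        refine (abs_sum_le_sum_abs _ _).trans (sum_le_sum fun i _ => ?_)
        have q1 := h (Pi.single i 1)
        have q2 := P_nonneg hQ (Pi.single i 1)
        rw [P_single] at q1 q2
        rw [sqNorm_single, mul_one] at q1
        rw [abs_mul, abs_of_nonneg q2, abs_pow]
        refine mul_le_mul q1 ?_ (by positivity) hK.le
        calc |Real.sin (ξ i / 2)| ^ 4 ≤ |Real.sin (ξ i / 2)| ^ 3 :=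
              pow_le_pow_of_le_one (abs_nonneg _) (Real.abs_sin_le_one _) (by norm_num)
          _ ≤ (s / 2) ^ 3 := by
              refine pow_le_pow_left₀ (abs_nonneg _) (Real.abs_sin_le_abs.trans ?_) 3
              rw [abs_div, abs_two]
              linarith [hξ i]
          _ = s ^ 3 / 8 := by ring
      rw [sum_const, card_univ, Fintype.card_fin, nsmul_eq_mul] at this
      have : 0 ≤ (d : ℝ) * (K * s ^ 3) := by positivity
      linarith
    rw [G_eq_P_sin_add hQ, add_sub_right_comm]
    refine (abs_add_le _ _).trans ?_
    linarith
  refine ⟨(4 * K + d * K) * (√k)⁻¹ ^ 3, by positivity, fun ξ => (key ξ).trans ?_⟩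
  rw [mul_assoc, ← mul_pow]
  refine mul_le_mul_of_nonneg_left (pow_le_pow_left₀ (Real.sqrt_nonneg _) ?_ 3) (by positivity)
  rw [le_inv_mul_iff₀ (Real.sqrt_pos.2 hk), ← Real.sqrt_mul hk.le]
  exact Real.sqrt_le_sqrt (h' ξ)

theorem continuous_P : Continuous (P Q) := by
  unfold P
  fun_prop

theorem contDiff_G : ContDiff ℝ 1 (G Q) := by
  unfold G
  fun_prop

end EllipticScaling

namespace EllipticScaling

open Finset

variable {d : ℕ} {A : Matrix (Fin d) (Fin d) ℤ} {Q : Matrix (Fin d) (Fin d) ℝ}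

/-! ### The dilation -/

theorem one_lt_norm_multiset_prod {s : Multiset ℂ} (hs : s ≠ 0) (h : ∀ z ∈ s, 1 < ‖z‖) :
    1 < ‖s.prod‖ := by
  induction s using Multiset.induction with
  | empty => exact absurd rfl hs
  | cons a s ih =>
    rw [Multiset.prod_cons, norm_mul]
    have ha := h a (Multiset.mem_cons_self a s)
    rcases eq_or_ne s 0 with rfl | hs'
    · simpa using ha
    · exact one_lt_mul_of_lt_of_le ha (ih hs' fun z hz => h z (Multiset.mem_cons_of_mem hz)).le

/-- The determinant is the product of the eigenvalues with multiplicity, and d ≥ 1 makes this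
product nonempty. -/
theorem one_lt_absDet (hd : 1 ≤ d) (hA : IsDilation A) : 1 < absDet A := by
  have h1 : ‖(A.map (Int.cast : ℤ → ℂ)).det‖ = absDet A := by
    have e1 : (A.map (Int.cast : ℤ → ℂ)).det = ((A.det : ℤ) : ℂ) :=
      (Int.cast_det A).symm
    have e2 : (realMat A).det = ((A.det : ℤ) : ℝ) := (Int.cast_det A).symm
    rw [e1, absDet, e2, Complex.norm_intCast]
  rw [← h1, Matrix.det_eq_prod_roots_charpoly]
  refine one_lt_norm_multiset_prod (fun h0 => ?_) fun z hz => ?_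
  · have h2 := IsAlgClosed.card_roots_eq_natDegree (p := (A.map (Int.cast : ℤ → ℂ)).charpoly)
    rw [h0, Matrix.charpoly_natDegree_eq_dim] at h2
    simp at h2
    omega
  · exact hA z (Matrix.mem_spectrum_iff_isRoot_charpoly.2 (Polynomial.isRoot_of_mem_roots hz))

/-- The contraction rate `q^{-1/d}` of `A^{-T}`. -/
noncomputable def ratio (A : Matrix (Fin d) (Fin d) ℤ) : ℝ := (absDet A ^ (1 / (d : ℝ)))⁻¹

theorem ratio_pos (hA : 1 < absDet A) : 0 < ratio A := by
  unfold ratio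
  have : 0 < absDet A := by linarith
  positivity

theorem ratio_lt_one (hd : 1 ≤ d) (hA : 1 < absDet A) : ratio A < 1 := by
  have : (0 : ℝ) < d := by exact_mod_cast hd
  exact inv_lt_one_of_one_lt₀ (Real.one_lt_rpow hA (by positivity))

/-- The factor q^{2/d} in μ exactly compensates the contraction of P by A^{-T}. -/
theorem absDet_rpow_mul_ratio_sq (hA : 1 < absDet A) :
    absDet A ^ (2 / (d : ℝ)) * ratio A ^ 2 = 1 := by
  have h0 : 0 < absDet A := by linarith
  rw [ratio, inv_pow, ← Real.rpow_natCast, ← Real.rpow_mul h0.le]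
  rw [show 1 / (d : ℝ) * (2 : ℕ) = 2 / d by push_cast; ring]
  exact mul_inv_cancel₀ (by positivity)

theorem isUnit_det_transpose (hA : 1 < absDet A) : IsUnit (realMat A).transpose.det := by
  rw [Matrix.det_transpose, isUnit_iff_ne_zero, ← abs_pos]
  exact lt_trans one_pos hA

theorem transpose_mulVec_invT (hA : 1 < absDet A) (x : Fin d → ℝ) :
    (realMat A).transpose.mulVec ((invT A).mulVec x) = x := by
  rw [Matrix.mulVec_mulVec, invT, Matrix.mul_nonsing_inv _ (isUnit_det_transpose hA),
    Matrix.one_mulVec]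

theorem invT_mulVec_transpose (hA : 1 < absDet A) (x : Fin d → ℝ) :
    (invT A).mulVec ((realMat A).transpose.mulVec x) = x := by
  rw [Matrix.mulVec_mulVec, invT, Matrix.nonsing_inv_mul _ (isUnit_det_transpose hA),
    Matrix.one_mulVec]

/-- Since P(x) = |Qx|² and Q A^{-T} = r U Q with U orthogonal, A^{-T} is a similarity for the norm
√P. -/
theorem P_invT (hQ : IsSimilarityFactor A Q) (x : Fin d → ℝ) :
    P Q ((invT A).mulVec x) = ratio A ^ 2 * P Q x := by
  obtain ⟨hpos, U, hU, h⟩ := hQ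
  have e : Q * invT A = ratio A • (U * Q) := by
    rw [h, Matrix.mul_smul, ← Matrix.mul_assoc, ← Matrix.mul_assoc,
      Matrix.mul_nonsing_inv _ hpos.det_pos.ne'.isUnit, Matrix.one_mul, ratio]
  have e2 : ∀ (c : ℝ) (y : Fin d → ℝ), sqNorm (c • y) = c ^ 2 * sqNorm y := fun c y => by
    simp [sqNorm, mul_sum, mul_pow]
  rw [P_eq_sqNorm hpos, P_eq_sqNorm hpos, Matrix.mulVec_mulVec, e, Matrix.smul_mulVec, e2,
    ← Matrix.mulVec_mulVec, sqNorm_mulVec_of_mem_orthogonalGroup hU]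

theorem sqrt_P_invT (hQ : IsSimilarityFactor A Q) (hA : 1 < absDet A) (x : Fin d → ℝ) :
    √(P Q ((invT A).mulVec x)) = ratio A * √(P Q x) := by
  rw [P_invT hQ, Real.sqrt_mul (sq_nonneg _), Real.sqrt_sq (ratio_pos hA).le]

theorem sqrt_P_invT_pow (hQ : IsSimilarityFactor A Q) (hA : 1 < absDet A) (j : ℕ)
    (x : Fin d → ℝ) : √(P Q ((invT A ^ j).mulVec x)) = ratio A ^ j * √(P Q x) := by
  induction j with
  | zero => simp
  | succ j ih =>
    rw [pow_succ', ← Matrix.mulVec_mulVec, sqrt_P_invT hQ hA, ih]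
    ring

theorem exists_norm_le_sqrt_P (hQ : Q.PosDef) :
    ∃ c, 0 < c ∧ ∀ ξ : Fin d → ℝ, ‖ξ‖ ≤ c * √(P Q ξ) := by
  obtain ⟨k, hk, h⟩ := exists_le_P hQ
  refine ⟨(√k)⁻¹, by positivity, fun ξ => ?_⟩
  rw [pi_norm_le_iff_of_nonneg (by positivity)]
  intro i
  rw [le_inv_mul_iff₀ (Real.sqrt_pos.2 hk)]
  refine Real.le_sqrt_of_sq_le ?_
  rw [mul_pow, Real.sq_sqrt hk.le, Real.norm_eq_abs, sq_abs]
  exact (mul_le_mul_of_nonneg_left (sq_le_sqNorm ξ i) hk.le).trans (h ξ)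

/-! ### Digits and the mask -/

/-- For s in the unit cube the integer vector Aᵀs is bounded by the absolute row sums of Aᵀ, and it
determines s. Finiteness makes the `∏ᶠ` in `mask` genuine products. -/
theorem finite_digitPts (hA : 1 < absDet A) : (digitPts A).Finite := by
  classical
  set T := (realMat A).transpose
  let b : Fin d → ℝ := fun i => ∑ j, |T i j|
  have hfin : (Set.Icc (fun i => -⌈b i⌉) (fun i => ⌈b i⌉)).Finite := Set.finite_Icc _ _
  refine (hfin.image fun n : Fin d → ℤ => (invT A).mulVec fun i => (n i : ℝ)).subset ?_
  rintro s ⟨hs, n, hn⟩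
  refine ⟨n, ?_, ?_⟩
  · have h1 : ∀ i, |(n i : ℝ)| ≤ ⌈b i⌉ := fun i => by
      refine le_trans ?_ (Int.le_ceil _)
      rw [← congrFun hn i]
      change |∑ j, T i j * s j| ≤ _
      refine (abs_sum_le_sum_abs _ _).trans (sum_le_sum fun j _ => ?_)
      rw [abs_mul]
      refine mul_le_of_le_one_right (abs_nonneg _) ?_
      rw [abs_of_nonneg (hs j).1]
      exact (hs j).2.le
    exact ⟨fun i => by exact_mod_cast (abs_le.1 (h1 i)).1,
      fun i => by exact_mod_cast (abs_le.1 (h1 i)).2⟩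
  · simp only [← hn]
    exact invT_mulVec_transpose hA s

/-- The digit is the fractional part of −A^{-T}n. It turns a shift of ξ by 2πn into a shift of
A^{-T}ξ by a digit, up to periods of G. -/
theorem exists_digit (hA : 1 < absDet A) (n : Fin d → ℤ) :
    ∃ s ∈ digitPts A, ∃ k : Fin d → ℤ,
      (invT A).mulVec (fun i => (n i : ℝ)) + s = fun i => (k i : ℝ) := by
  set x := (invT A).mulVec (fun i => (n i : ℝ)) with hx
  refine ⟨fun i => Int.fract (-x i), ⟨fun i => ⟨Int.fract_nonneg _, Int.fract_lt_one _⟩,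
    fun i => -n i - ∑ j, A j i * ⌊-x j⌋, ?_⟩, fun i => -⌊-x i⌋, ?_⟩
  · have e : (fun i => Int.fract (-x i)) = -x - fun i => (⌊-x i⌋ : ℝ) := by
      funext i
      exact (Int.self_sub_floor _).symm
    rw [e, Matrix.mulVec_sub, Matrix.mulVec_neg, hx, transpose_mulVec_invT hA]
    funext i
    simp [Matrix.mulVec, dotProduct, realMat]
  · funext i
    have := Int.self_sub_floor (-x i)
    simp only [Pi.add_apply]
    push_cast
    linarith

theorem G_two_pi_digit_pos (hQ : Q.PosDef) {s : Fin d → ℝ} (hs : s ∈ digitPts A \ {0}) :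
    0 < G Q ((2 * Real.pi) • s) := by
  refine lt_of_le_of_ne (G_nonneg hQ _) fun h => hs.2 ?_
  obtain ⟨n, hn⟩ := (G_eq_zero_iff hQ).1 h.symm
  have h2 : s = fun i => (n i : ℝ) := smul_right_injective _ (by positivity) hn
  funext i
  have h3 : 0 ≤ (n i : ℝ) ∧ (n i : ℝ) < 1 := by
    have := hs.1.1 i
    rwa [h2] at this
  rw [h2]
  have h4 : 0 ≤ n i := by exact_mod_cast h3.1
  have h5 : n i < 1 := by exact_mod_cast h3.2
  have h6 : n i = 0 := by omega
  simp [h6]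

theorem exists_mask_eq_prod (hA : 1 < absDet A) : ∃ S : Finset (Fin d → ℝ),
    (S : Set (Fin d → ℝ)) = digitPts A \ {0} ∧ ∀ ξ, mask A Q ξ =
      ∏ s ∈ S, G Q (ξ + (2 * Real.pi) • s) / G Q ((2 * Real.pi) • s) := by
  have hfin : (digitPts A \ {0}).Finite := (finite_digitPts hA).sdiff
  refine ⟨hfin.toFinset, hfin.coe_toFinset, fun ξ => ?_⟩
  rw [mask, finprod_mem_eq_finite_toFinset_prod _ hfin,
    finprod_mem_eq_finite_toFinset_prod _ hfin, prod_div_distrib]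

theorem mask_nonneg (hA : 1 < absDet A) (hQ : Q.PosDef) (ξ : Fin d → ℝ) : 0 ≤ mask A Q ξ := by
  obtain ⟨S, -, h⟩ := exists_mask_eq_prod (Q := Q) hA
  rw [h]
  exact prod_nonneg fun s _ => div_nonneg (G_nonneg hQ _) (G_nonneg hQ _)

theorem mask_zero (hA : 1 < absDet A) (hQ : Q.PosDef) : mask A Q 0 = 1 := by
  obtain ⟨S, hS, h⟩ := exists_mask_eq_prod (Q := Q) hA
  rw [h]
  refine prod_eq_one fun s hs => ?_
  rw [zero_add]
  exact div_self (G_two_pi_digit_pos hQ (hS ▸ mem_coe.2 hs)).ne'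

theorem differentiable_mask (hA : 1 < absDet A) : Differentiable ℝ (mask A Q) := by
  obtain ⟨S, -, h⟩ := exists_mask_eq_prod (Q := Q) hA
  rw [show mask A Q = fun ξ => _ from funext h]
  have h1 : ContDiff ℝ 1 fun ξ =>
      ∏ s ∈ S, G Q (ξ + (2 * Real.pi) • s) / G Q ((2 * Real.pi) • s) :=
    contDiff_prod fun s _ =>
      (contDiff_G.comp (contDiff_id.add contDiff_const)).div_const _
  exact h1.differentiable one_ne_zero

/-- Up to a constant, m₀(ξ)G(ξ) is the product of the G(ξ + 2πs) over all digits s, including 0. All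
factors are bounded, so the product is at most a constant times any single one. -/
theorem exists_mask_le (hA : 1 < absDet A) (hQ : Q.PosDef) : ∃ C, 0 < C ∧
    (∀ ξ, mask A Q ξ ≤ C) ∧
    ∀ s ∈ digitPts A, ∀ ξ, mask A Q ξ * G Q ξ ≤ C * G Q (ξ + (2 * Real.pi) • s) := by
  classical
  obtain ⟨S, hS, h⟩ := exists_mask_eq_prod (Q := Q) hA
  obtain ⟨K, hK, hG⟩ := exists_G_le_const hQ
  -- L dominates every normalizing factor 1/G(2πs). K' dominates every factor of the mask and is at
  -- least 1, so products over subsets of S are at most K' ^ #S.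
  set L := ∑ s ∈ S, (G Q ((2 * Real.pi) • s))⁻¹ with hL
  have hL0 : 0 ≤ L := sum_nonneg fun s _ => inv_nonneg.2 (G_nonneg hQ _)
  set K' := 1 + L * K with hK'
  have hK'1 : 1 ≤ K' := by rw [hK']; nlinarith
  have h0 : ∀ s ξ, 0 ≤ G Q (ξ + (2 * Real.pi) • s) / G Q ((2 * Real.pi) • s) :=
    fun s ξ => div_nonneg (G_nonneg hQ _) (G_nonneg hQ _)
  have h1 : ∀ s ∈ S, ∀ ξ, G Q (ξ + (2 * Real.pi) • s) / G Q ((2 * Real.pi) • s) ≤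
      L * G Q (ξ + (2 * Real.pi) • s) := fun s hs ξ => by
    rw [div_eq_inv_mul]
    exact mul_le_mul_of_nonneg_right (single_le_sum
      (f := fun s => (G Q ((2 * Real.pi) • s))⁻¹)
      (fun s _ => inv_nonneg.2 (G_nonneg hQ _)) hs) (G_nonneg hQ _)
  have h2 : ∀ s ∈ S, ∀ ξ, G Q (ξ + (2 * Real.pi) • s) / G Q ((2 * Real.pi) • s) ≤ K' :=
    fun s hs ξ => (h1 s hs ξ).trans (by
      have := mul_le_mul_of_nonneg_left (hG (ξ + (2 * Real.pi) • s)) hL0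
      linarith)
  have h3 : ∀ S' ⊆ S, ∀ ξ, ∏ s ∈ S', G Q (ξ + (2 * Real.pi) • s) / G Q ((2 * Real.pi) • s) ≤
      K' ^ #S := fun S' hS' ξ => by
    refine (prod_le_prod (fun s _ => h0 s ξ) fun s hs => h2 s (hS' hs) ξ).trans ?_
    rw [prod_const]
    exact pow_le_pow_right₀ hK'1 (card_le_card hS')
  have hKS : 0 < K' ^ #S := by positivity
  have hC : 0 ≤ L * K' ^ #S * K := by positivity
  refine ⟨K' ^ #S + L * K' ^ #S * K, by linarith, fun ξ => ?_, fun s hs ξ => ?_⟩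
  · rw [h]
    linarith [h3 S (Subset.refl S) ξ]
  · rcases eq_or_ne s 0 with rfl | hs0
    · rw [smul_zero, add_zero]
      refine mul_le_mul_of_nonneg_right ?_ (G_nonneg hQ _)
      rw [h]
      linarith [h3 S (Subset.refl S) ξ]
    · have hsS : s ∈ S := by
        rw [← mem_coe, hS]
        exact ⟨hs, hs0⟩
      have hg := G_nonneg hQ (ξ + (2 * Real.pi) • s)
      have h4 : mask A Q ξ ≤ L * G Q (ξ + (2 * Real.pi) • s) * K' ^ #S := by
        rw [h, ← mul_prod_erase S _ hsS]
        exact mul_le_mul (h1 s hsS ξ) (h3 _ (erase_subset _ _) ξ)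
          (prod_nonneg fun s _ => h0 s ξ) (mul_nonneg hL0 hg)
      calc mask A Q ξ * G Q ξ ≤ L * G Q (ξ + (2 * Real.pi) • s) * K' ^ #S * K :=
            mul_le_mul h4 (hG ξ) (G_nonneg hQ _) (mul_nonneg (mul_nonneg hL0 hg) hKS.le)
        _ = L * K' ^ #S * K * G Q (ξ + (2 * Real.pi) • s) := by ring
        _ ≤ _ := mul_le_mul_of_nonneg_right (by linarith) hg

/-- Differentiability at 0 gives the bound near 0; away from 0 the boundedness of m₀ suffices, at
the cost of the factor 1/δ. -/
theorem exists_abs_mask_sub_one_le (hA : 1 < absDet A) (hQ : Q.PosDef) :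
    ∃ C, 0 ≤ C ∧ ∀ ξ, |mask A Q ξ - 1| ≤ C * √(P Q ξ) := by
  obtain ⟨K, hK, hm, -⟩ := exists_mask_le hA hQ
  obtain ⟨c, hc, hn⟩ := exists_norm_le_sqrt_P hQ
  obtain ⟨C, hC, hO⟩ := ((differentiable_mask (Q := Q) hA) 0).hasFDerivAt.isBigO_sub.exists_pos
  rw [Asymptotics.isBigOWith_iff, Metric.eventually_nhds_iff] at hO
  obtain ⟨δ, hδ, hO⟩ := hO
  have key : ∀ ξ, |mask A Q ξ - 1| ≤ (C + (K + 1) / δ) * ‖ξ‖ := fun ξ => by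
    have p1 : 0 ≤ (K + 1) / δ * ‖ξ‖ := by positivity
    have p2 : 0 ≤ C * ‖ξ‖ := by positivity
    rcases lt_or_ge ‖ξ‖ δ with h | h
    · have := hO (y := ξ) (by simpa using h)
      rw [mask_zero hA hQ, sub_zero, Real.norm_eq_abs] at this
      linarith
    · have h1 : |mask A Q ξ - 1| ≤ K + 1 := by
        refine (abs_sub _ _).trans ?_
        rw [abs_of_nonneg (mask_nonneg hA hQ ξ), abs_one]
        linarith [hm ξ]
      have h2 : K + 1 ≤ (K + 1) / δ * ‖ξ‖ := by
        rw [div_mul_eq_mul_div, le_div_iff₀ hδ]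
        exact mul_le_mul_of_nonneg_left h (by linarith)
      linarith
  refine ⟨(C + (K + 1) / δ) * c, by positivity, fun ξ => (key ξ).trans ?_⟩
  rw [mul_assoc]
  exact mul_le_mul_of_nonneg_left (hn ξ) (by positivity)

/-! ### The function `μ` -/

/-- The integer matrix Aᵀ maps the zero set 2πℤ^d of G into itself. -/
theorem G_ne_zero_of_invT (hA : 1 < absDet A) (hQ : Q.PosDef) {ξ : Fin d → ℝ}
    (h : G Q ξ ≠ 0) : G Q ((invT A).mulVec ξ) ≠ 0 := by
  intro h0
  obtain ⟨n, hn⟩ := (G_eq_zero_iff hQ).1 h0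
  refine h ((G_eq_zero_iff hQ).2 ⟨fun i => ∑ j, A j i * n j, ?_⟩)
  rw [← transpose_mulVec_invT hA ξ, hn, Matrix.mulVec_smul]
  congr 1
  funext i
  simp [Matrix.mulVec, dotProduct, realMat]

theorem G_ne_zero_of_invT_pow (hA : 1 < absDet A) (hQ : Q.PosDef) {ξ : Fin d → ℝ}
    (h : G Q ξ ≠ 0) (j : ℕ) : G Q ((invT A ^ j).mulVec ξ) ≠ 0 := by
  induction j with
  | zero => simpa using h
  | succ j ih =>
    rw [pow_succ', ← Matrix.mulVec_mulVec]
    exact G_ne_zero_of_invT hA hQ ih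

/-- If G vanishes at A^{-T}ξ + 2πs, applying Aᵀ puts ξ in 2πℤ^d, as Aᵀs is integral. So the
numerator of μ has no zeros besides those of the denominator. -/
theorem mask_invT_pos (hA : 1 < absDet A) (hQ : Q.PosDef) {ξ : Fin d → ℝ}
    (h : G Q ξ ≠ 0) : 0 < mask A Q ((invT A).mulVec ξ) := by
  obtain ⟨S, hS, hm⟩ := exists_mask_eq_prod (Q := Q) hA
  rw [hm]
  refine prod_pos fun s hs => div_pos ?_ (G_two_pi_digit_pos hQ (hS ▸ mem_coe.2 hs))
  refine lt_of_le_of_ne (G_nonneg hQ _) fun h0 => h ?_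
  have hsd : s ∈ digitPts A := (hS ▸ mem_coe.2 hs : s ∈ digitPts A \ {0}).1
  obtain ⟨-, k, hk⟩ := hsd
  obtain ⟨n, hn⟩ := (G_eq_zero_iff hQ).1 h0.symm
  refine (G_eq_zero_iff hQ).2 ⟨fun i => ∑ j, A j i * n j - k i, ?_⟩
  have h1 := congrArg (realMat A).transpose.mulVec hn
  rw [Matrix.mulVec_add, transpose_mulVec_invT hA, Matrix.mulVec_smul, hk,
    Matrix.mulVec_smul] at h1
  rw [eq_sub_of_add_eq h1, ← smul_sub]
  congr 1
  funext i
  simp [Matrix.mulVec, dotProduct, realMat]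

theorem mu_pos (hA : 1 < absDet A) (hQ : Q.PosDef) (ξ : Fin d → ℝ) : 0 < mu A Q ξ := by
  unfold mu
  split_ifs with h
  · exact one_pos
  · have h0 : 0 < absDet A := by linarith
    have h1 := (G_nonneg hQ ξ).lt_of_ne' h
    have h2 := (G_nonneg hQ _).lt_of_ne' (G_ne_zero_of_invT hA hQ h)
    have h3 := mask_invT_pos hA hQ h
    positivity

/-- The zeros of the denominator are cancelled as follows. Let ζ be the representative of ξ mod
2πℤ^d in the period cube and s the digit with A^{-T}ξ + 2πs ≡ A^{-T}ζ. Then m₀G at A^{-T}ξ is at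
most C·G(A^{-T}ζ) ≤ CK·P(A^{-T}ζ) = CKr²·P(ζ) ≤ CKK'r²·G(ξ), and q^{2/d} r² = 1. -/
theorem exists_mu_le (hA : 1 < absDet A) (hQ : IsSimilarityFactor A Q) :
    ∃ C, 1 ≤ C ∧ ∀ ξ, mu A Q ξ ≤ C := by
  obtain ⟨C, hC, -, hm⟩ := exists_mask_le hA hQ.1
  obtain ⟨K, hK, hG⟩ := exists_G_le_P hQ.1
  obtain ⟨K', hK', hP⟩ := exists_P_le_G hQ.1
  have h0 : 0 < absDet A := by linarith
  refine ⟨1 + C * K * K', by nlinarith [mul_pos (mul_pos hC hK) hK'], fun ξ => ?_⟩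
  have hpos : 0 < C * K * K' := by positivity
  unfold mu
  split_ifs with h
  · linarith
  set n : Fin d → ℤ := fun i => round (ξ i / (2 * Real.pi))
  set ζ : Fin d → ℝ := ξ - (2 * Real.pi) • fun i => (n i : ℝ) with hζ
  have hξ : ξ = ζ + (2 * Real.pi) • fun i => (n i : ℝ) := by rw [hζ, sub_add_cancel]
  have hζπ : ∀ i, |ζ i| ≤ Real.pi := fun i => by
    have h1 := abs_sub_round (ξ i / (2 * Real.pi))
    have h2 : ζ i = 2 * Real.pi * (ξ i / (2 * Real.pi) - n i) := by
      simp only [hζ, Pi.sub_apply, Pi.smul_apply, smul_eq_mul]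
      field_simp
    rw [h2, abs_mul, abs_of_pos (by positivity)]
    have := mul_le_mul_of_nonneg_left h1 (show 0 ≤ 2 * Real.pi by positivity)
    linarith
  obtain ⟨s, hs, k, hk⟩ := exists_digit hA n
  have h1 := hm s hs ((invT A).mulVec ξ)
  have h2 : (invT A).mulVec ξ + (2 * Real.pi) • s =
      (invT A).mulVec ζ + (2 * Real.pi) • fun i => (k i : ℝ) := by
    rw [hξ, Matrix.mulVec_add, Matrix.mulVec_smul, add_assoc, ← smul_add, hk]
  rw [h2, G_add_lattice] at h1
  have h3 := hG ((invT A).mulVec ζ)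
  rw [P_invT hQ] at h3
  have h4 := hP ζ hζπ
  have h5 : G Q ζ = G Q ξ := by rw [hξ, G_add_lattice]
  rw [h5] at h4
  have h6 := (G_nonneg hQ.1 ξ).lt_of_ne' h
  rw [div_le_iff₀ h6, mul_assoc]
  set q := absDet A ^ (2 / (d : ℝ)) with hq
  have hq0 : 0 < q := by positivity
  have hr := absDet_rpow_mul_ratio_sq hA
  calc q * (mask A Q ((invT A).mulVec ξ) * G Q ((invT A).mulVec ξ))
      ≤ q * (C * (K * (ratio A ^ 2 * (K' * G Q ξ)))) := by
        refine mul_le_mul_of_nonneg_left (h1.trans (mul_le_mul_of_nonneg_left (h3.trans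
          (mul_le_mul_of_nonneg_left (mul_le_mul_of_nonneg_left h4 (sq_nonneg _)) hK.le))
          hC.le)) hq0.le
    _ = q * ratio A ^ 2 * (C * K * K' * G Q ξ) := by ring
    _ = C * K * K' * G Q ξ := by rw [hr, one_mul]
    _ ≤ _ := mul_le_mul_of_nonneg_right (by linarith) h6.le

/-- With N = √P(ξ): in the period cube, numerator minus denominator is O(N³), since the quadratic
terms cancel, while the denominator is at least N²/K'. Outside the cube N is bounded below and the
boundedness of μ suffices. -/
theorem exists_abs_mu_sub_one_le (hA : 1 < absDet A) (hQ : IsSimilarityFactor A Q) :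
    ∃ C, 0 ≤ C ∧ ∀ ξ, |mu A Q ξ - 1| ≤ C * √(P Q ξ) := by
  obtain ⟨Λ, hΛ, hmu⟩ := exists_mu_le hA hQ
  obtain ⟨c, hc, hn⟩ := exists_norm_le_sqrt_P hQ.1
  obtain ⟨Cm, hCm, hmask⟩ := exists_abs_mask_sub_one_le hA hQ.1
  obtain ⟨Cg, hCg, hGP⟩ := exists_abs_G_sub_P_le hQ.1
  obtain ⟨K, hK, hG⟩ := exists_G_le_P hQ.1
  obtain ⟨K', hK', hP⟩ := exists_P_le_G hQ.1
  have h0 : 0 < absDet A := by linarith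
  set q := absDet A ^ (2 / (d : ℝ)) with hq
  have hq0 : 0 < q := by positivity
  have hr := absDet_rpow_mul_ratio_sq hA
  have hr0 := ratio_pos hA
  rw [← hq] at hr
  set r := ratio A with hrdef
  set C1 := Cm * r * K + Cg * r + Cg with hC1
  have hC1' : 0 ≤ C1 := by positivity
  refine ⟨C1 * K' + (Λ + 1) * c / Real.pi, by positivity, fun ξ => ?_⟩
  set N := √(P Q ξ) with hN
  have hN0 : 0 ≤ N := Real.sqrt_nonneg _
  have hN2 : N ^ 2 = P Q ξ := Real.sq_sqrt (P_nonneg hQ.1 ξ)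
  have p1 : 0 ≤ C1 * K' * N := by positivity
  have p2 : 0 ≤ (Λ + 1) * c / Real.pi * N := by positivity
  rw [add_mul]
  by_cases h : ‖ξ‖ ≤ Real.pi
  · refine le_trans ?_ (le_add_of_nonneg_right p2)
    unfold mu
    split_ifs with hG0
    · simpa using p1
    have h6 := (G_nonneg hQ.1 ξ).lt_of_ne' hG0
    rw [← hq, div_sub_one hG0, abs_div, abs_of_pos h6, div_le_iff₀ h6]
    set η := (invT A).mulVec ξ
    have hNη : √(P Q η) = r * N := sqrt_P_invT hQ hA ξ
    have hPη : P Q η = r ^ 2 * P Q ξ := P_invT hQ ξ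
    have e1 := hmask η
    have e2 := hGP η
    have e3 := hGP ξ
    have e4 := hG η
    rw [hNη] at e1 e2
    rw [hPη, ← hN2] at e4
    have e5 := hP ξ fun i => (norm_le_pi_norm ξ i).trans h
    rw [← hN2] at e5
    have e6 : q * mask A Q η * G Q η - G Q ξ = q * ((mask A Q η - 1) * G Q η) +
        q * (G Q η - P Q η) - (G Q ξ - P Q ξ) := by
      rw [hPη]
      linear_combination P Q ξ * hr
    have f1 : |q * ((mask A Q η - 1) * G Q η)| ≤ Cm * r * K * N ^ 3 := by
      rw [abs_mul, abs_mul, abs_of_pos hq0, abs_of_nonneg (G_nonneg hQ.1 η)]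
      calc q * (|mask A Q η - 1| * G Q η) ≤ q * (Cm * (r * N) * (K * (r ^ 2 * N ^ 2))) :=
            mul_le_mul_of_nonneg_left (mul_le_mul e1 e4 (G_nonneg hQ.1 η) (by positivity)) hq0.le
        _ = q * r ^ 2 * (Cm * r * K * N ^ 3) := by ring
        _ = _ := by rw [hr, one_mul]
    have f2 : |q * (G Q η - P Q η)| ≤ Cg * r * N ^ 3 := by
      rw [abs_mul, abs_of_pos hq0]
      calc q * |G Q η - P Q η| ≤ q * (Cg * (r * N) ^ 3) := mul_le_mul_of_nonneg_left e2 hq0.le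
        _ = q * r ^ 2 * (Cg * r * N ^ 3) := by ring
        _ = _ := by rw [hr, one_mul]
    rw [e6]
    calc _ ≤ Cm * r * K * N ^ 3 + Cg * r * N ^ 3 + Cg * N ^ 3 :=
          (abs_sub _ _).trans (add_le_add ((abs_add_le _ _).trans (add_le_add f1 f2)) e3)
      _ = C1 * N * N ^ 2 := by rw [hC1]; ring
      _ ≤ C1 * N * (K' * G Q ξ) := mul_le_mul_of_nonneg_left e5 (by positivity)
      _ = _ := by ring
  · push Not at h
    refine le_trans ?_ (le_add_of_nonneg_left p1)
    have h1 : |mu A Q ξ - 1| ≤ Λ + 1 := by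
      refine (abs_sub _ _).trans ?_
      rw [abs_of_pos (mu_pos hA hQ.1 ξ), abs_one]
      linarith [hmu ξ]
    refine h1.trans ?_
    rw [div_mul_eq_mul_div, le_div_iff₀ Real.pi_pos, mul_assoc]
    exact mul_le_mul_of_nonneg_left (h.le.trans (hn ξ)) (by linarith)

end EllipticScaling

namespace EllipticScaling

open Finset Filter
open scoped Topology

variable {d : ℕ} {A : Matrix (Fin d) (Fin d) ℤ} {Q : Matrix (Fin d) (Fin d) ℝ}

/-! ### Infinite products -/

section Products

variable {a : ℕ → ℝ} {c r : ℝ}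

theorem summable_sub_one_of_geometric (hr0 : 0 ≤ r) (hr : r < 1)
    (h : ∀ j, |a j - 1| ≤ c * r ^ j) : Summable fun j => a j - 1 :=
  Summable.of_norm_bounded ((summable_geometric_of_lt_one hr0 hr).mul_left c) h

theorem multipliable_of_geometric (hr0 : 0 ≤ r) (hr : r < 1)
    (h : ∀ j, |a j - 1| ≤ c * r ^ j) : Multipliable a := by
  simpa using Real.multipliable_one_add_of_summable (summable_sub_one_of_geometric hr0 hr h)

/-- A convergent product of positive factors could still be 0; here the logarithms are summable, so
the product is an exponential. -/
theorem tprod_pos_of_geometric (hr0 : 0 ≤ r) (hr : r < 1)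
    (h : ∀ j, |a j - 1| ≤ c * r ^ j) (ha : ∀ j, 0 < a j) : 0 < ∏' j, a j := by
  rw [← Real.rexp_tsum_eq_tprod ha]
  · exact Real.exp_pos _
  · simpa using Real.summable_log_one_add_of_summable (summable_sub_one_of_geometric hr0 hr h)

theorem tprod_le_exp_of_geometric (hr0 : 0 ≤ r) (hr : r < 1)
    (h : ∀ j, |a j - 1| ≤ c * r ^ j) (ha : ∀ j, 0 ≤ a j) :
    ∏' j, a j ≤ Real.exp (c * (1 - r)⁻¹) := by
  have hc : 0 ≤ c := by
    have := (abs_nonneg _).trans (h 0)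
    simpa using this
  refine le_of_tendsto (multipliable_of_geometric hr0 hr h).hasProd.tendsto_prod_nat
    (Eventually.of_forall fun n => ?_)
  calc ∏ j ∈ range n, a j ≤ ∏ j ∈ range n, Real.exp (c * r ^ j) :=
        prod_le_prod (fun j _ => ha j) fun j _ => by
          have h1 := Real.add_one_le_exp (c * r ^ j)
          have h2 := (abs_le.1 (h j)).2
          linarith
    _ = Real.exp (∑ j ∈ range n, c * r ^ j) := (Real.exp_sum _ _).symm
    _ ≤ _ := by
      rw [Real.exp_le_exp, ← mul_sum]
      refine mul_le_mul_of_nonneg_left ?_ hc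
      rw [← tsum_geometric_of_lt_one hr0 hr]
      exact (summable_geometric_of_lt_one hr0 hr).sum_le_tsum _ fun j _ => by positivity

end Products

/-! ### Convergence, positivity and growth of `M`. -/

theorem exists_abs_mu_invT_pow_sub_one_le (hA : 1 < absDet A) (hQ : IsSimilarityFactor A Q) :
    ∃ C, 0 ≤ C ∧ ∀ ξ j, |mu A Q ((invT A ^ j).mulVec ξ) - 1| ≤ C * √(P Q ξ) * ratio A ^ j := by
  obtain ⟨C, hC, h⟩ := exists_abs_mu_sub_one_le hA hQ
  refine ⟨C, hC, fun ξ j => (h _).trans (le_of_eq ?_)⟩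
  rw [sqrt_P_invT_pow hQ hA]
  ring

theorem multipliable_mu (hd : 1 ≤ d) (hA : 1 < absDet A) (hQ : IsSimilarityFactor A Q)
    (ξ : Fin d → ℝ) : Multipliable fun j => mu A Q ((invT A ^ j).mulVec ξ) := by
  obtain ⟨C, -, h⟩ := exists_abs_mu_invT_pow_sub_one_le hA hQ
  exact multipliable_of_geometric (ratio_pos hA).le (ratio_lt_one hd hA) (h ξ)

theorem M_pos (hd : 1 ≤ d) (hA : 1 < absDet A) (hQ : IsSimilarityFactor A Q)
    (ξ : Fin d → ℝ) : 0 < M A Q ξ := by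
  obtain ⟨C, -, h⟩ := exists_abs_mu_invT_pow_sub_one_le hA hQ
  exact tprod_pos_of_geometric (ratio_pos hA).le (ratio_lt_one hd hA) (h ξ)
    fun j => mu_pos hA hQ.1 _

theorem M_eq_mu_mul (hd : 1 ≤ d) (hA : 1 < absDet A) (hQ : IsSimilarityFactor A Q)
    (ξ : Fin d → ℝ) : M A Q ξ = mu A Q ξ * M A Q ((invT A).mulVec ξ) := by
  have e : ∀ j, (invT A ^ (j + 1)).mulVec ξ = (invT A ^ j).mulVec ((invT A).mulVec ξ) :=
    fun j => by rw [pow_succ, Matrix.mulVec_mulVec]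
  have h := multipliable_mu hd hA hQ ((invT A).mulVec ξ)
  unfold M
  rw [tprod_eq_zero_mul' (by simpa only [e] using h)]
  simp only [e, pow_zero, Matrix.one_mulVec]

/-- `M` grows at most polynomially. -/
theorem exists_M_le (hd : 1 ≤ d) (hA : 1 < absDet A) (hQ : IsSimilarityFactor A Q) :
    ∃ C, 0 < C ∧ ∃ k : ℕ, ∀ ξ, M A Q ξ ≤ C * max 1 (√(P Q ξ) / ratio A) ^ k := by
  have hr0 := ratio_pos hA
  have hr1 := ratio_lt_one hd hA
  obtain ⟨C, hC, h⟩ := exists_abs_mu_invT_pow_sub_one_le hA hQ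
  obtain ⟨Λ, hΛ, hmu⟩ := exists_mu_le hA hQ
  -- The exponent k is chosen with Λ ≤ r^{-k}: one use of M(ξ) = μ(ξ) M(A^{-T}ξ) costs at most the
  -- factor r^{-k}, while √P shrinks by r.
  obtain ⟨k, hk⟩ := exists_pow_lt_of_lt_one (inv_pos.2 (zero_lt_one.trans_le hΛ)) hr1
  set C1 := Real.exp (C * (1 - ratio A)⁻¹) with hC1
  have hC1' : 0 < C1 := Real.exp_pos _
  have hΛk : Λ ≤ (ratio A)⁻¹ ^ k := by
    rw [inv_pow, le_inv_comm₀ (by linarith) (by positivity)]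
    exact hk.le
  have hsmall : ∀ ξ, √(P Q ξ) ≤ 1 → M A Q ξ ≤ C1 := fun ξ hξ => by
    refine tprod_le_exp_of_geometric hr0.le hr1 (fun j => (h ξ j).trans ?_)
      fun j => (mu_pos hA hQ.1 _).le
    exact mul_le_mul_of_nonneg_right (mul_le_of_le_one_right hC hξ) (by positivity)
  refine ⟨C1, hC1', k, ?_⟩
  -- Induction on the number of contractions that bring ξ into the unit ball of √P. Dividing by r
  -- inside the maximum makes the bound at A^{-T}ξ equal to C1 · N^k when N > 1, and the factor
  -- r^{-k} restores (N / r)^k.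
  have key : ∀ n : ℕ, ∀ ξ, √(P Q ξ) * ratio A ^ n ≤ 1 →
      M A Q ξ ≤ C1 * max 1 (√(P Q ξ) / ratio A) ^ k := by
    intro n
    induction n with
    | zero =>
      intro ξ hξ
      refine (hsmall ξ (by simpa using hξ)).trans ?_
      exact le_mul_of_one_le_right hC1'.le (one_le_pow₀ (le_max_left _ _))
    | succ n ih =>
      intro ξ hξ
      set N := √(P Q ξ) with hN
      rcases le_or_gt N 1 with h1 | h1
      · exact (hsmall ξ h1).trans
          (le_mul_of_one_le_right hC1'.le (one_le_pow₀ (le_max_left _ _)))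
      · have h2 := ih ((invT A).mulVec ξ) (by
          rw [sqrt_P_invT hQ hA, ← hN]
          rwa [pow_succ', ← mul_assoc, mul_comm N] at hξ)
        rw [sqrt_P_invT hQ hA, ← hN, mul_div_cancel_left₀ _ hr0.ne', max_eq_right h1.le] at h2
        rw [M_eq_mu_mul hd hA hQ]
        calc mu A Q ξ * M A Q ((invT A).mulVec ξ) ≤ (ratio A)⁻¹ ^ k * (C1 * N ^ k) :=
              mul_le_mul ((hmu ξ).trans hΛk) h2 (M_pos hd hA hQ _).le (by positivity)
          _ = C1 * (N / ratio A) ^ k := by rw [div_eq_mul_inv, mul_pow]; ring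
          _ ≤ _ := mul_le_mul_of_nonneg_left
              (pow_le_pow_left₀ (by positivity) (le_max_right _ _) k) hC1'.le
  intro ξ
  have ht : Tendsto (fun n : ℕ => √(P Q ξ) * ratio A ^ n) atTop (𝓝 (√(P Q ξ) * 0)) :=
    (tendsto_pow_atTop_nhds_zero_of_lt_one hr0.le hr1).const_mul _
  rw [mul_zero] at ht
  obtain ⟨n, hn⟩ := (ht.eventually_le_const zero_lt_one).exists
  exact key n ξ hn

theorem measurable_mu (hA : 1 < absDet A) : Measurable (mu A Q) := by
  have hG : Measurable (G Q) := contDiff_G.continuous.measurable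
  have hm : Measurable (mask A Q) := (differentiable_mask hA).continuous.measurable
  have hB : Measurable (invT A).mulVec := (Continuous.matrix_mulVec continuous_const
    continuous_id).measurable
  unfold mu
  refine Measurable.ite (hG (measurableSet_singleton 0)) measurable_const ?_
  exact ((measurable_const.mul (hm.comp hB)).mul (hG.comp hB)).div hG

theorem measurable_M (hd : 1 ≤ d) (hA : 1 < absDet A) (hQ : IsSimilarityFactor A Q) :
    Measurable (M A Q) := by
  refine measurable_of_tendsto_metrizable
    (f := fun n ξ => ∏ j ∈ range n, mu A Q ((invT A ^ j).mulVec ξ)) (fun n => ?_)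
    (tendsto_pi_nhds.2 fun ξ => (multipliable_mu hd hA hQ ξ).hasProd.tendsto_prod_nat)
  refine Finset.measurable_fun_prod _ fun j _ => (measurable_mu hA).comp ?_
  exact (Continuous.matrix_mulVec continuous_const continuous_id).measurable

/-! ### The identity φ̂ = (M / P) G. -/

/-- Telescoping: each μ contributes a value of m₀, a factor q^{2/d} and a quotient of consecutive
values of G along the orbit of ξ. -/
theorem prod_mu_mul_G (hA : 1 < absDet A) (hQ : Q.PosDef) {ξ : Fin d → ℝ} (h : G Q ξ ≠ 0)
    (n : ℕ) : (∏ j ∈ range n, mu A Q ((invT A ^ j).mulVec ξ)) * G Q ξ =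
      (∏ j ∈ range n, mask A Q ((invT A ^ (j + 1)).mulVec ξ)) *
        ((absDet A ^ (2 / (d : ℝ))) ^ n * G Q ((invT A ^ n).mulVec ξ)) := by
  induction n with
  | zero => simp
  | succ n ih =>
    have h1 := G_ne_zero_of_invT_pow hA hQ h n
    rw [prod_range_succ, mul_right_comm, ih, prod_range_succ, mu, if_neg h1,
      Matrix.mulVec_mulVec, ← pow_succ' (invT A)]
    field_simp
    ring

/-- With P in place of G the sequence is constant; the cubic error of G − P contributes q^{2n/d}
r^{3n} = r^n. -/
theorem tendsto_G_invT_pow (hd : 1 ≤ d) (hA : 1 < absDet A) (hQ : IsSimilarityFactor A Q)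
    (ξ : Fin d → ℝ) : Tendsto (fun n : ℕ => (absDet A ^ (2 / (d : ℝ))) ^ n *
      G Q ((invT A ^ n).mulVec ξ)) atTop (𝓝 (P Q ξ)) := by
  obtain ⟨C, hC, h⟩ := exists_abs_G_sub_P_le hQ.1
  have hr0 := ratio_pos hA
  have hr := absDet_rpow_mul_ratio_sq hA
  have h0 : 0 < absDet A := by linarith
  set q := absDet A ^ (2 / (d : ℝ)) with hq
  have hq0 : 0 < q := by positivity
  have hPn : ∀ n : ℕ, q ^ n * P Q ((invT A ^ n).mulVec ξ) = P Q ξ := fun n => by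
    rw [← Real.sq_sqrt (P_nonneg hQ.1 ((invT A ^ n).mulVec ξ)), sqrt_P_invT_pow hQ hA, mul_pow,
      Real.sq_sqrt (P_nonneg hQ.1 ξ), ← pow_mul, mul_comm n, pow_mul, ← mul_assoc, ← mul_pow, hr,
      one_pow, one_mul]
  rw [tendsto_iff_norm_sub_tendsto_zero]
  have ht : Tendsto (fun n : ℕ => C * √(P Q ξ) ^ 3 * ratio A ^ n) atTop
      (𝓝 (C * √(P Q ξ) ^ 3 * 0)) :=
    (tendsto_pow_atTop_nhds_zero_of_lt_one hr0.le (ratio_lt_one hd hA)).const_mul _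
  rw [mul_zero] at ht
  refine squeeze_zero (fun _ => norm_nonneg _) (fun n => ?_) ht
  rw [← hPn n, ← mul_sub, Real.norm_eq_abs, abs_mul, abs_of_pos (by positivity), hPn n]
  calc q ^ n * |G Q ((invT A ^ n).mulVec ξ) - P Q ((invT A ^ n).mulVec ξ)|
      ≤ q ^ n * (C * (ratio A ^ n * √(P Q ξ)) ^ 3) := by
        rw [← sqrt_P_invT_pow hQ hA]
        exact mul_le_mul_of_nonneg_left (h _) (by positivity)
    _ = (q * ratio A ^ 2) ^ n * (C * √(P Q ξ) ^ 3 * ratio A ^ n) := by ring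
    _ = _ := by rw [hr, one_pow, one_mul]

theorem multipliable_mask (hd : 1 ≤ d) (hA : 1 < absDet A) (hQ : IsSimilarityFactor A Q)
    (ξ : Fin d → ℝ) : Multipliable fun j => mask A Q ((invT A ^ (j + 1)).mulVec ξ) := by
  obtain ⟨C, hC, h⟩ := exists_abs_mask_sub_one_le hA hQ.1
  refine multipliable_of_geometric (c := C * ratio A * √(P Q ξ)) (ratio_pos hA).le
    (ratio_lt_one hd hA) fun j => (h _).trans (le_of_eq ?_)
  rw [sqrt_P_invT_pow hQ hA]
  ring

theorem measurable_phiHat (hd : 1 ≤ d) (hA : 1 < absDet A) (hQ : IsSimilarityFactor A Q) :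
    Measurable (phiHat A Q) := by
  refine measurable_of_tendsto_metrizable
    (f := fun n ξ => ∏ j ∈ range n, mask A Q ((invT A ^ (j + 1)).mulVec ξ)) (fun n => ?_)
    (tendsto_pi_nhds.2 fun ξ => (multipliable_mask hd hA hQ ξ).hasProd.tendsto_prod_nat)
  refine Finset.measurable_fun_prod _ fun j _ =>
    (differentiable_mask hA).continuous.measurable.comp ?_
  exact (Continuous.matrix_mulVec continuous_const continuous_id).measurable

theorem M_mul_G_eq (hd : 1 ≤ d) (hA : 1 < absDet A) (hQ : IsSimilarityFactor A Q)
    {ξ : Fin d → ℝ} (h : G Q ξ ≠ 0) : M A Q ξ * G Q ξ = phiHat A Q ξ * P Q ξ := by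
  have h1 := ((multipliable_mu hd hA hQ ξ).hasProd.tendsto_prod_nat).mul_const (G Q ξ)
  have h2 := ((multipliable_mask hd hA hQ ξ).hasProd.tendsto_prod_nat).mul
    (tendsto_G_invT_pow hd hA hQ ξ)
  simp only [prod_mu_mul_G hA hQ.1 h] at h1
  exact tendsto_nhds_unique h1 h2

/-- The zeros of `G` form a countable set. -/
theorem countable_zeros_G (hQ : Q.PosDef) : {ξ | G Q ξ = 0}.Countable := by
  refine (Set.countable_range fun n : Fin d → ℤ => (2 * Real.pi) • fun i => (n i : ℝ)).mono ?_
  rintro ξ hξ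
  obtain ⟨n, hn⟩ := (G_eq_zero_iff hQ).1 hξ
  exact ⟨n, hn.symm⟩

/-- Lebesgue measure has no atoms because d ≥ 1. -/
theorem ae_G_ne_zero (hd : 1 ≤ d) (hQ : Q.PosDef) :
    ∀ᵐ ξ : EuclideanSpace ℝ (Fin d), G Q ξ.ofLp ≠ 0 := by
  have : Nonempty (Fin d) := ⟨⟨0, hd⟩⟩
  have h := (countable_zeros_G hQ).preimage_of_injOn
    (f := (WithLp.ofLp : EuclideanSpace ℝ (Fin d) → Fin d → ℝ))
    (WithLp.ofLp_injective 2).injOn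
  exact measure_eq_zero_iff_ae_notMem.1 (h.measure_zero volume)

/-- Off the zeros of `G`: `φ̂ = M G / P`. -/
theorem phiHat_eq (hd : 1 ≤ d) (hA : 1 < absDet A) (hQ : IsSimilarityFactor A Q)
    {ξ : Fin d → ℝ} (h : G Q ξ ≠ 0) : phiHat A Q ξ = M A Q ξ / P Q ξ * G Q ξ := by
  have hP : P Q ξ ≠ 0 := fun h0 => h (by
    rw [(P_eq_zero hQ.1).1 h0, G_eq_zero_iff hQ.1]
    exact ⟨0, by ext; simp⟩)
  rw [div_mul_eq_mul_div, M_mul_G_eq hd hA hQ h, mul_div_cancel_right₀ _ hP]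

/-! ### Bounds on Euclidean space -/

theorem exists_M_le_norm (hd : 1 ≤ d) (hA : 1 < absDet A) (hQ : IsSimilarityFactor A Q) :
    ∃ C, 0 < C ∧ ∃ k : ℕ, ∀ ξ : EuclideanSpace ℝ (Fin d),
      M A Q ξ.ofLp ≤ C * (1 + ‖ξ‖) ^ k := by
  obtain ⟨C, hC, k, h⟩ := exists_M_le hd hA hQ
  obtain ⟨K, hK, hP⟩ := exists_P_le hQ.1
  have hr := ratio_pos hA
  refine ⟨C * (1 + √K / ratio A) ^ k, by positivity, k, fun ξ => (h ξ.ofLp).trans ?_⟩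
  rw [mul_assoc, ← mul_pow]
  refine mul_le_mul_of_nonneg_left (pow_le_pow_left₀ (by positivity) ?_ k) hC.le
  have h1 : √(P Q ξ.ofLp) ≤ √K * ‖ξ‖ := by
    rw [← Real.sqrt_sq (norm_nonneg ξ), ← Real.sqrt_mul hK.le, ← sqNorm_ofLp]
    exact Real.sqrt_le_sqrt (hP _)
  have h2 : √(P Q ξ.ofLp) / ratio A ≤ √K / ratio A * ‖ξ‖ := by
    rw [div_mul_eq_mul_div]
    exact div_le_div_of_nonneg_right h1 hr.le
  have h3 : 0 ≤ √K / ratio A := by positivity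
  have h4 := norm_nonneg ξ
  refine max_le ?_ ?_ <;> nlinarith

theorem exists_norm_sq_le_P (hQ : Q.PosDef) :
    ∃ k, 0 < k ∧ ∀ ξ : EuclideanSpace ℝ (Fin d), k * ‖ξ‖ ^ 2 ≤ P Q ξ.ofLp := by
  obtain ⟨k, hk, h⟩ := exists_le_P hQ
  exact ⟨k, hk, fun ξ => by rw [← sqNorm_ofLp]; exact h _⟩

end EllipticScaling

namespace EllipticScaling

open Filter
open scoped Topology

/-! ### Regularization of functions with a singularity at the origin -/

/-- A linear functional that is continuous on the kernel of a continuous linear map of finite rank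
is continuous. -/
theorem continuous_of_le_on_ker {X V : Type*} [AddCommGroup X] [Module ℂ X] [TopologicalSpace X]
    [IsTopologicalAddGroup X] [ContinuousSMul ℂ X] [NormedAddCommGroup V] [NormedSpace ℂ V]
    [FiniteDimensional ℂ V] (Φ : X →L[ℂ] V) (T : X →ₗ[ℂ] ℂ) (p : X → ℝ) (hp : Continuous p)
    (hp0 : p 0 = 0) (h : ∀ x, Φ x = 0 → ‖T x‖ ≤ p x) : Continuous T := by
  -- With s a linear section of Φ over its finite-dimensional range, e = s ∘ Φ is continuous and x −
  -- e x lies in the kernel of Φ. So T splits into a part controlled by p and a part factoring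
  -- through a finite-dimensional space.
  obtain ⟨s, hs⟩ := LinearMap.exists_rightInverse_of_surjective Φ.toLinearMap.rangeRestrict
    (LinearMap.range_rangeRestrict _)
  have hsc : Continuous s := s.continuous_of_finiteDimensional
  have hΦr : Continuous Φ.toLinearMap.rangeRestrict :=
    Continuous.subtype_mk Φ.continuous _
  set e : X →ₗ[ℂ] X := s ∘ₗ Φ.toLinearMap.rangeRestrict with he
  have hec : Continuous e := hsc.comp hΦr
  have hΦe : ∀ x, Φ (e x) = Φ x := fun x =>
    congrArg Subtype.val (LinearMap.congr_fun hs (Φ.toLinearMap.rangeRestrict x))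
  have h1 : Continuous fun x => T (x - e x) := by
    have h0 : Tendsto (fun x => p (x - e x)) (𝓝 0) (𝓝 0) := by
      have h2 : Continuous fun x => p (x - e x) := hp.comp (continuous_id.sub hec)
      simpa [hp0] using h2.tendsto 0
    refine continuous_of_continuousAt_zero (T ∘ₗ (LinearMap.id - e)) ?_
    have h2 := squeeze_zero_norm (f := fun x => T (x - e x))
      (fun x => h _ (by rw [map_sub, hΦe, sub_self])) h0
    rw [ContinuousAt, map_zero]
    exact h2
  have h2 : Continuous fun x => T (e x) :=
    ((T ∘ₗ s).continuous_of_finiteDimensional).comp hΦr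
  have h3 : ⇑T = fun x => T (x - e x) + T (e x) := by
    funext x
    rw [← map_add, sub_add_cancel]
  rw [h3]
  exact h1.add h2

section Regularization

variable {E : Type*} [NormedAddCommGroup E] [NormedSpace ℝ E]

/-- A Schwartz function whose derivatives of order less than `N` vanish at the origin is
`O(‖x‖ ^ N)`. -/
theorem norm_le_of_iteratedFDeriv_eq_zero {N : ℕ} {η : 𝓢(E, ℂ)}
    (h : ∀ k < N, iteratedFDeriv ℝ k η 0 = 0) (x : E) :
    ‖η x‖ ≤ SchwartzMap.seminorm ℂ 0 N η * ‖x‖ ^ N := by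
  set S := SchwartzMap.seminorm ℂ 0 N η with hS
  have hS0 : 0 ≤ S := apply_nonneg _ _
  -- Downward induction on the order k of the derivative: each use of the mean value inequality on
  -- the ball of radius ‖x‖ gains one power of ‖x‖.
  have key : ∀ j k, k + j = N → ∀ x, ‖iteratedFDeriv ℝ k η x‖ ≤ S * ‖x‖ ^ j := by
    intro j
    induction j with
    | zero =>
      rintro k rfl x
      rw [pow_zero, mul_one]
      exact SchwartzMap.norm_iteratedFDeriv_le_seminorm ℂ η k x
    | succ j ih =>
      intro k hk x
      have h1 := Convex.norm_image_sub_le_of_norm_fderiv_le (𝕜 := ℝ)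
        (f := iteratedFDeriv ℝ k η) (C := S * ‖x‖ ^ j) (s := Metric.closedBall 0 ‖x‖)
        (x := 0) (y := x)
        (fun y _ => ((η.smooth ⊤).differentiable_iteratedFDeriv
          (by exact_mod_cast WithTop.coe_lt_top _)) y)
        (fun y hy => by
          rw [norm_fderiv_iteratedFDeriv]
          refine (ih (k + 1) (by omega) y).trans ?_
          exact mul_le_mul_of_nonneg_left
            (pow_le_pow_left₀ (norm_nonneg _) (by simpa using hy) j) hS0)
        (convex_closedBall _ _) (by simp) (by simp)
      rw [h k (by omega), sub_zero, sub_zero, mul_assoc, ← pow_succ] at h1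
      exact h1
  simpa using key N 0 (zero_add N) x

/-- The Taylor coefficients of order less than `N` at the origin. -/
theorem exists_jet (E : Type*) [NormedAddCommGroup E] [NormedSpace ℝ E] [FiniteDimensional ℝ E]
    (N : ℕ) : ∃ (n : ℕ) (Φ : 𝓢(E, ℂ) →L[ℂ]
      ((k : Fin N) → (Fin k → Fin n) → ℂ)),
      ∀ η, Φ η = 0 → ∀ k < N, iteratedFDeriv ℝ k η 0 = 0 := by
  let b := Module.finBasis ℝ E
  have hΦ : ∀ (k : ℕ) (v : Fin k → E), ∃ Ψ : 𝓢(E, ℂ) →L[ℂ] ℂ,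
      ∀ η, Ψ η = iteratedFDeriv ℝ k η 0 v := fun k v => by
    refine ⟨SchwartzMap.mkCLMtoNormedSpace (σ := RingHom.id ℂ)
      (fun η => iteratedFDeriv ℝ k η 0 v) (fun f g => ?_) (fun a f => ?_)
      ⟨{(0, k)}, ∏ i, ‖v i‖, by positivity, fun f => ?_⟩, fun η => rfl⟩
    · rw [show ⇑(f + g) = ⇑f + ⇑g from rfl, iteratedFDeriv_add_apply (f.smooth k).contDiffAt
        (g.smooth k).contDiffAt]
      rfl
    · rw [show ⇑(a • f) = a • ⇑f from rfl, iteratedFDeriv_const_smul_apply (f.smooth k).contDiffAt]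
      rfl
    · refine (ContinuousMultilinearMap.le_opNorm _ _).trans ?_
      rw [mul_comm, Finset.sup_singleton]
      exact mul_le_mul_of_nonneg_left (SchwartzMap.norm_iteratedFDeriv_le_seminorm ℂ f k 0)
        (by positivity)
  choose Ψ hΨ using hΦ
  -- A derivative is determined by its values on tuples of basis vectors, so finitely many
  -- functionals suffice.
  refine ⟨_, ContinuousLinearMap.pi fun k => ContinuousLinearMap.pi fun w => Ψ k (b ∘ w),
    fun η h k hk => ?_⟩
  apply ContinuousMultilinearMap.toMultilinearMap_injective
  refine Module.Basis.ext_multilinear (fun _ => b) fun w => ?_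
  have h1 := congrFun (congrFun h ⟨k, hk⟩) w
  simp only [ContinuousLinearMap.pi_apply, hΨ] at h1
  exact h1

/-- In the unit ball the vanishing of η to order N absorbs the singularity; outside it the decay of
η absorbs the growth K. The n spare powers make the majorant integrable once n exceeds the
dimension. -/
theorem norm_mul_le_of_iteratedFDeriv_eq_zero {N K n : ℕ} {C : ℝ} {z : ℂ} {ξ : E}
    (hC : 0 ≤ C) (hz : ‖ξ‖ ^ N * ‖z‖ ≤ C * (1 + ‖ξ‖) ^ K) {η : 𝓢(E, ℂ)}
    (h : ∀ k < N, iteratedFDeriv ℝ k η 0 = 0) :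
    ‖z * η ξ‖ ≤ C * 2 ^ (K + n) * (SchwartzMap.seminorm ℂ 0 N η +
      SchwartzMap.seminorm ℂ (K + n) 0 η) * (1 + ‖ξ‖) ^ (-(n : ℝ)) := by
  have p1 : 0 ≤ SchwartzMap.seminorm ℂ 0 N η := apply_nonneg _ _
  have p2 : 0 ≤ SchwartzMap.seminorm ℂ (K + n) 0 η := apply_nonneg _ _
  have hξ := norm_nonneg ξ
  rw [Real.rpow_neg (by positivity), Real.rpow_natCast, ← div_eq_mul_inv,
    le_div_iff₀ (by positivity), norm_mul]
  rcases le_or_gt ‖ξ‖ 1 with h1 | h1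
  · have h2 : (1 + ‖ξ‖) ^ (K + n) ≤ 2 ^ (K + n) :=
      pow_le_pow_left₀ (by positivity) (by linarith) _
    calc ‖z‖ * ‖η ξ‖ * (1 + ‖ξ‖) ^ n
        ≤ ‖z‖ * (SchwartzMap.seminorm ℂ 0 N η * ‖ξ‖ ^ N) * (1 + ‖ξ‖) ^ n := by
          gcongr
          exact norm_le_of_iteratedFDeriv_eq_zero h ξ
      _ = ‖ξ‖ ^ N * ‖z‖ * SchwartzMap.seminorm ℂ 0 N η * (1 + ‖ξ‖) ^ n := by ring
      _ ≤ C * (1 + ‖ξ‖) ^ K * SchwartzMap.seminorm ℂ 0 N η * (1 + ‖ξ‖) ^ n := by gcongr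
      _ = C * (1 + ‖ξ‖) ^ (K + n) * SchwartzMap.seminorm ℂ 0 N η := by ring
      _ ≤ C * 2 ^ (K + n) * (SchwartzMap.seminorm ℂ 0 N η +
          SchwartzMap.seminorm ℂ (K + n) 0 η) := by gcongr; linarith
  · have h2 : ‖z‖ ≤ C * (1 + ‖ξ‖) ^ K :=
      (le_mul_of_one_le_left (norm_nonneg z) (one_le_pow₀ h1.le)).trans hz
    have h3 : (1 + ‖ξ‖) ^ (K + n) ≤ 2 ^ (K + n) * ‖ξ‖ ^ (K + n) := by
      rw [← mul_pow]
      exact pow_le_pow_left₀ (by positivity) (by linarith) _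
    have h4 := SchwartzMap.norm_pow_mul_le_seminorm ℂ η (K + n) ξ
    calc ‖z‖ * ‖η ξ‖ * (1 + ‖ξ‖) ^ n
        ≤ C * (1 + ‖ξ‖) ^ K * ‖η ξ‖ * (1 + ‖ξ‖) ^ n := by gcongr
      _ = C * (1 + ‖ξ‖) ^ (K + n) * ‖η ξ‖ := by ring
      _ ≤ C * (2 ^ (K + n) * ‖ξ‖ ^ (K + n)) * ‖η ξ‖ := by gcongr
      _ = C * 2 ^ (K + n) * (‖ξ‖ ^ (K + n) * ‖η ξ‖) := by ring
      _ ≤ C * 2 ^ (K + n) * (SchwartzMap.seminorm ℂ 0 N η +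
          SchwartzMap.seminorm ℂ (K + n) 0 η) := by gcongr; linarith

variable [FiniteDimensional ℝ E] [MeasurableSpace E] [BorelSpace E] {μ : Measure E}
  [μ.IsAddHaarMeasure]

/-- A function with a singularity of finite order at the origin and polynomial growth at infinity
times a Schwartz function that vanishes to that order at the origin is integrable. -/
theorem integrable_mul_and_norm_integral_le {N K : ℕ} {C : ℝ} {f : E → ℂ} (hC : 0 ≤ C)
    (hf : AEStronglyMeasurable f μ) (hb : ∀ᵐ ξ ∂μ, ‖ξ‖ ^ N * ‖f ξ‖ ≤ C * (1 + ‖ξ‖) ^ K) :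
    ∃ C', ∀ η : 𝓢(E, ℂ), (∀ k < N, iteratedFDeriv ℝ k η 0 = 0) →
      Integrable (fun ξ => f ξ * η ξ) μ ∧
      ‖∫ ξ, f ξ * η ξ ∂μ‖ ≤ C' * (SchwartzMap.seminorm ℂ 0 N η +
        SchwartzMap.seminorm ℂ (K + (Module.finrank ℝ E + 1)) 0 η) := by
  set n := Module.finrank ℝ E + 1 with hn
  have hint : Integrable (fun ξ : E => (1 + ‖ξ‖) ^ (-(n : ℝ))) μ :=
    integrable_one_add_norm (by rw [hn]; push_cast; linarith)
  refine ⟨C * 2 ^ (K + n) * ∫ ξ, (1 + ‖ξ‖) ^ (-(n : ℝ)) ∂μ, fun η h => ?_⟩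
  have hle : ∀ᵐ ξ ∂μ, ‖f ξ * η ξ‖ ≤ C * 2 ^ (K + n) * (SchwartzMap.seminorm ℂ 0 N η +
      SchwartzMap.seminorm ℂ (K + n) 0 η) * (1 + ‖ξ‖) ^ (-(n : ℝ)) := by
    filter_upwards [hb] with ξ hξ
    exact norm_mul_le_of_iteratedFDeriv_eq_zero hC hξ h
  refine ⟨(hint.const_mul _).mono' (hf.mul η.continuous.aestronglyMeasurable) hle, ?_⟩
  refine (norm_integral_le_of_norm_le (hint.const_mul _) hle).trans (le_of_eq ?_)
  rw [integral_const_mul]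
  ring

/-- Every function with a singularity of finite order at the origin and polynomial growth at
infinity has a regularization. -/
theorem exists_regularization {N K : ℕ} {C : ℝ} {f : E → ℂ} (hC : 0 ≤ C)
    (hf : AEStronglyMeasurable f μ) (hb : ∀ᵐ ξ ∂μ, ‖ξ‖ ^ N * ‖f ξ‖ ≤ C * (1 + ‖ξ‖) ^ K) :
    ∃ T : 𝓢(E, ℂ) →L[ℂ] ℂ, ∀ η : 𝓢(E, ℂ), Integrable (fun ξ => f ξ * η ξ) μ →
      T η = ∫ ξ, f ξ * η ξ ∂μ := by
  let W : Submodule ℂ 𝓢(E, ℂ) :=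
    { carrier := {η | Integrable (fun ξ => f ξ * η ξ) μ}
      add_mem' := fun {a b} ha hb => by
        refine (Integrable.add ha hb).congr (Eventually.of_forall fun ξ => ?_)
        simp [mul_add]
      zero_mem' := by simp
      smul_mem' := fun c η h => by
        refine (Integrable.const_mul h c).congr (Eventually.of_forall fun ξ => ?_)
        simp only [_root_.smul_apply, smul_eq_mul]
        ring }
  let T₀ : W →ₗ[ℂ] ℂ :=
    { toFun := fun η => ∫ ξ, f ξ * η.1 ξ ∂μ
      map_add' := fun a b => by
        rw [← integral_add a.2 b.2]
        refine integral_congr_ae (Eventually.of_forall fun ξ => ?_)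
        simp [mul_add]
      map_smul' := fun c η => by
        rw [RingHom.id_apply, smul_eq_mul, ← integral_const_mul]
        refine integral_congr_ae (Eventually.of_forall fun ξ => ?_)
        simp only [Submodule.coe_smul, _root_.smul_apply, smul_eq_mul]
        ring }
  -- T is an arbitrary linear extension of the integral. It is continuous all the same: the
  -- functions with vanishing jet lie in W, the integral is bounded there by seminorms, and
  -- `continuous_of_le_on_ker` applies.
  obtain ⟨T, hT⟩ := LinearMap.exists_extend T₀
  have hT' : ∀ η : 𝓢(E, ℂ), Integrable (fun ξ => f ξ * η ξ) μ → T η = ∫ ξ, f ξ * η ξ ∂μ :=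
    fun η h => LinearMap.congr_fun hT ⟨η, h⟩
  obtain ⟨C', hC'⟩ := integrable_mul_and_norm_integral_le hC hf hb
  obtain ⟨n, Φ, hΦ⟩ := exists_jet E N
  have hs : ∀ k l, Continuous fun η : 𝓢(E, ℂ) => SchwartzMap.seminorm ℂ k l η := fun k l =>
    (schwartz_withSeminorms ℂ E ℂ).continuous_seminorm (k, l)
  have hp : Continuous fun η : 𝓢(E, ℂ) => C' * (SchwartzMap.seminorm ℂ 0 N η +
      SchwartzMap.seminorm ℂ (K + (Module.finrank ℝ E + 1)) 0 η) :=
    continuous_const.mul ((hs 0 N).add (hs (K + (Module.finrank ℝ E + 1)) 0))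
  refine ⟨⟨T, continuous_of_le_on_ker Φ T _ hp (by simp) fun η h => ?_⟩, hT'⟩
  obtain ⟨h1, h2⟩ := hC' η (hΦ η h)
  rw [hT' η h1]
  exact h2

theorem locallyIntegrableOn_of_bound {N K : ℕ} {C : ℝ} {f : E → ℂ}
    (hf : AEStronglyMeasurable f μ) (hb : ∀ᵐ ξ ∂μ, ‖ξ‖ ^ N * ‖f ξ‖ ≤ C * (1 + ‖ξ‖) ^ K) :
    LocallyIntegrableOn f {0}ᶜ μ := by
  intro x hx
  have hx0 : 0 < ‖x‖ := norm_pos_iff.2 hx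
  refine ⟨Metric.ball x (‖x‖ / 2), mem_nhdsWithin_of_mem_nhds
    (Metric.ball_mem_nhds x (by linarith)), ?_⟩
  refine IntegrableOn.of_bound measure_ball_lt_top hf.restrict
    (|C| * (1 + 2 * ‖x‖) ^ K / (‖x‖ / 2) ^ N) ?_
  filter_upwards [ae_restrict_of_ae hb, ae_restrict_mem Metric.isOpen_ball.measurableSet]
    with ξ hξ hmem
  rw [Metric.mem_ball, dist_eq_norm] at hmem
  have h1 : ‖x‖ / 2 ≤ ‖ξ‖ := by
    have := norm_sub_norm_le x ξ
    rw [norm_sub_rev] at this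
    linarith
  have h2 : ‖ξ‖ ≤ 2 * ‖x‖ := by
    have := norm_sub_norm_le ξ x
    linarith
  rw [le_div_iff₀ (by positivity)]
  calc ‖f ξ‖ * (‖x‖ / 2) ^ N ≤ ‖f ξ‖ * ‖ξ‖ ^ N := by gcongr
    _ = ‖ξ‖ ^ N * ‖f ξ‖ := mul_comm _ _
    _ ≤ C * (1 + ‖ξ‖) ^ K := hξ
    _ ≤ |C| * (1 + ‖ξ‖) ^ K := by gcongr; exact le_abs_self C
    _ ≤ |C| * (1 + 2 * ‖x‖) ^ K := by gcongr

end Regularization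

end EllipticScaling

namespace EllipticScaling

open Filter
open scoped Topology

variable {d : ℕ}

/-! ### The Fourier transform of tempered distributions -/

/-- The inverse of `fourierS`. -/
noncomputable def fourierSInv (d : ℕ) :
    𝓢(EuclideanSpace ℝ (Fin d), ℂ) →L[ℂ] 𝓢(EuclideanSpace ℝ (Fin d), ℂ) :=
  (FourierTransform.fourierInvCLM ℂ 𝓢(EuclideanSpace ℝ (Fin d), ℂ)).comp
    (SchwartzMap.compCLMOfContinuousLinearEquiv ℂ (scale d).symm)

theorem fourierSInv_fourierS (η : 𝓢(EuclideanSpace ℝ (Fin d), ℂ)) :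
    fourierSInv d (fourierS d η) = η := by
  have h : SchwartzMap.compCLMOfContinuousLinearEquiv ℂ (scale d).symm
      (SchwartzMap.compCLMOfContinuousLinearEquiv ℂ (scale d)
        (FourierTransform.fourierCLM ℂ 𝓢(EuclideanSpace ℝ (Fin d), ℂ) η)) =
      FourierTransform.fourierCLM ℂ 𝓢(EuclideanSpace ℝ (Fin d), ℂ) η := by
    ext x
    simp
  rw [fourierSInv, fourierS, ContinuousLinearMap.comp_apply, ContinuousLinearMap.comp_apply, h]
  simp

theorem fourierS_fourierSInv (η : 𝓢(EuclideanSpace ℝ (Fin d), ℂ)) :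
    fourierS d (fourierSInv d η) = η := by
  rw [fourierSInv, fourierS, ContinuousLinearMap.comp_apply, ContinuousLinearMap.comp_apply]
  ext x
  simp

theorem fourierT_apply (u : 𝓢'(EuclideanSpace ℝ (Fin d), ℂ))
    (η : 𝓢(EuclideanSpace ℝ (Fin d), ℂ)) : fourierT u η = u (fourierS d η) := rfl

theorem fourierT_injective : Function.Injective (fourierT (d := d)) := by
  intro u v h
  ext η
  rw [← fourierS_fourierSInv η, ← fourierT_apply, h, fourierT_apply]

theorem exists_fourierT_eq (T : 𝓢(EuclideanSpace ℝ (Fin d), ℂ) →L[ℂ] ℂ) :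
    ∃ u : 𝓢'(EuclideanSpace ℝ (Fin d), ℂ), ∀ η, fourierT u η = T η := by
  let T' : 𝓢'(EuclideanSpace ℝ (Fin d), ℂ) := T
  refine ⟨PointwiseConvergenceCLM.precomp ℂ (fourierSInv d) T', fun η => ?_⟩
  change T (fourierSInv d (fourierS d η)) = T η
  rw [fourierSInv_fourierS]

theorem exists_hasFourierTransform {N K : ℕ} {C : ℝ} {f : EuclideanSpace ℝ (Fin d) → ℂ}
    (hC : 0 ≤ C) (hf : AEStronglyMeasurable f volume)
    (hb : ∀ᵐ ξ, ‖ξ‖ ^ N * ‖f ξ‖ ≤ C * (1 + ‖ξ‖) ^ K) : ∃ u, HasFourierTransform u f := by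
  obtain ⟨T, hT⟩ := exists_regularization hC hf hb
  obtain ⟨u, hu⟩ := exists_fourierT_eq T
  exact ⟨u, locallyIntegrableOn_of_bound hf hb, fun η h => (hu η).trans (hT η h)⟩

theorem integrable_mul_schwartz {K : ℕ} {C : ℝ} {f : EuclideanSpace ℝ (Fin d) → ℂ}
    (hC : 0 ≤ C) (hf : AEStronglyMeasurable f volume)
    (hb : ∀ᵐ ξ, ‖f ξ‖ ≤ C * (1 + ‖ξ‖) ^ K) (η : 𝓢(EuclideanSpace ℝ (Fin d), ℂ)) :
    Integrable fun ξ => f ξ * η ξ := by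
  obtain ⟨_, h⟩ := integrable_mul_and_norm_integral_le (N := 0) hC hf (by simpa using hb)
  exact (h η (by simp)).1

/-- In general two regularizations may differ by a distribution supported at the origin; the
hypothesis `hf` leaves no such freedom. -/
theorem HasFourierTransform.unique {u v : 𝓢'(EuclideanSpace ℝ (Fin d), ℂ)}
    {f : EuclideanSpace ℝ (Fin d) → ℂ} (hu : HasFourierTransform u f)
    (hv : HasFourierTransform v f)
    (hf : ∀ η : 𝓢(EuclideanSpace ℝ (Fin d), ℂ), Integrable fun ξ => f ξ * η ξ) : u = v := by
  refine fourierT_injective ?_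
  ext η
  rw [hu.2 η (hf η), hv.2 η (hf η)]

theorem HasFourierTransform.congr_ae {u : 𝓢'(EuclideanSpace ℝ (Fin d), ℂ)}
    {f g : EuclideanSpace ℝ (Fin d) → ℂ} (hu : HasFourierTransform u f) (h : f =ᵐ[volume] g) :
    HasFourierTransform u g := by
  have hm : ∀ η : 𝓢(EuclideanSpace ℝ (Fin d), ℂ),
      (fun ξ => f ξ * η ξ) =ᵐ[volume] fun ξ => g ξ * η ξ := fun η => by
    filter_upwards [h] with ξ hξ
    rw [hξ]
  refine ⟨fun x hx => ?_, fun η hη => ?_⟩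
  · obtain ⟨s, hs, hi⟩ := hu.1 x hx
    exact ⟨s, hs, hi.congr (ae_restrict_of_ae h)⟩
  · rw [hu.2 η (hη.congr (hm η).symm), integral_congr_ae (hm η)]

theorem LocallyIntegrableOn.integrable_smul {E F : Type*} [NormedAddCommGroup E] [NormedSpace ℝ E]
    [MeasurableSpace E] [BorelSpace E] [NormedAddCommGroup F] [NormedSpace ℝ F] {μ : Measure E}
    {U : Set E} {f : E → F} (hf : LocallyIntegrableOn f U μ) {g : E → ℝ} (hg : Continuous g)
    (hc : HasCompactSupport g) (hU : tsupport g ⊆ U) : Integrable (fun x => g x • f x) μ := by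
  have h1 : IntegrableOn f (tsupport g) μ := hf.integrableOn_compact_subset hU hc
  have h2 : IntegrableOn (fun x => g x • f x) (tsupport g) μ :=
    h1.continuousOn_smul hg.continuousOn hc
  refine (integrableOn_iff_integrable_of_support_subset ?_).1 h2
  exact (Function.support_smul_subset_left g f).trans (subset_tsupport g)

/-- The Fourier transform of a tempered distribution determines the function off the origin. -/
theorem HasFourierTransform.ae_eq (hd : 1 ≤ d) {u : 𝓢'(EuclideanSpace ℝ (Fin d), ℂ)}
    {f g : EuclideanSpace ℝ (Fin d) → ℂ} (hf : HasFourierTransform u f)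
    (hg : HasFourierTransform u g) : f =ᵐ[volume] g := by
  have : Nonempty (Fin d) := ⟨⟨0, hd⟩⟩
  have h := isOpen_compl_singleton.ae_eq_zero_of_integral_contDiff_smul_eq_zero
    (hf.1.sub hg.1) fun η hη hc hs => ?_
  · have h0 : ∀ᵐ ξ : EuclideanSpace ℝ (Fin d), ξ ≠ 0 :=
      measure_eq_zero_iff_ae_notMem.1 (measure_singleton (0 : EuclideanSpace ℝ (Fin d)))
    filter_upwards [h, h0] with ξ h1 h2
    exact sub_eq_zero.1 (h1 h2)
  · have hc' : HasCompactSupport fun x => (η x : ℂ) := hc.comp_left Complex.ofReal_zero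
    have hη' : ContDiff ℝ (↑(⊤ : ℕ∞)) fun x => (η x : ℂ) := Complex.ofRealCLM.contDiff.comp hη
    let ψ : 𝓢(EuclideanSpace ℝ (Fin d), ℂ) := hc'.toSchwartzMap hη'
    have hψ : ∀ x, ψ x = η x := fun x => rfl
    -- For test functions supported off the origin both integrals converge, so both equal the value
    -- of û.
    have hi : ∀ f : EuclideanSpace ℝ (Fin d) → ℂ, LocallyIntegrableOn f {0}ᶜ volume →
        Integrable fun x => f x * ψ x := fun f hf => by
      refine (LocallyIntegrableOn.integrable_smul hf hη.continuous hc hs).congr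
        (Eventually.of_forall fun x => ?_)
      simp only [hψ, Complex.real_smul, mul_comm]
    have h1 := hf.2 ψ (hi f hf.1)
    rw [hg.2 ψ (hi g hg.1), eq_comm, ← sub_eq_zero,
      ← integral_sub (hi f hf.1) (hi g hg.1)] at h1
    rw [← h1]
    refine integral_congr_ae (Eventually.of_forall fun x => ?_)
    simp only [hψ, Pi.sub_apply, Complex.real_smul]
    ring

/-! ### Trigonometric polynomials -/

/-- All derivatives have absolute value 1. This is what allows multiplying Schwartz functions by
characters. -/
theorem hasTemperateGrowth_exp_neg_I_mul :
    (fun t : ℝ => Complex.exp (-Complex.I * t)).HasTemperateGrowth := by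
  have hder : ∀ n : ℕ, iteratedDeriv n (fun t : ℝ => Complex.exp (-Complex.I * t)) =
      fun t : ℝ => (-Complex.I) ^ n * Complex.exp (-Complex.I * t) := fun n => by
    induction n with
    | zero => simp
    | succ n ih =>
      rw [iteratedDeriv_succ, ih]
      funext t
      have h1 : HasDerivAt (fun t : ℝ => -Complex.I * (t : ℂ)) (-Complex.I) t := by
        simpa using (Complex.ofRealCLM.hasDerivAt (x := t)).const_mul (-Complex.I)
      rw [(h1.cexp.const_mul _).deriv]
      ring
  refine ⟨Complex.contDiff_exp.comp (contDiff_const.mul Complex.ofRealCLM.contDiff), fun n =>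
    ⟨0, 1, fun t => ?_⟩⟩
  rw [norm_iteratedFDeriv_eq_norm_iteratedDeriv, hder, norm_mul, norm_pow, norm_neg,
    Complex.norm_I, one_pow, one_mul, show -Complex.I * (t : ℂ) = ((-t : ℝ) : ℂ) * Complex.I by
      push_cast; ring, Complex.norm_exp_ofReal_mul_I]
  simp

/-- The character `ξ ↦ e^{-i a·ξ}`. -/
noncomputable def character (a ξ : EuclideanSpace ℝ (Fin d)) : ℂ :=
  Complex.exp (-Complex.I * (inner ℝ a ξ : ℝ))

theorem hasTemperateGrowth_character (a : EuclideanSpace ℝ (Fin d)) :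
    (character a).HasTemperateGrowth :=
  hasTemperateGrowth_exp_neg_I_mul.comp
    (Function.hasTemperateGrowth_inner_right a)

theorem character_add (a b ξ : EuclideanSpace ℝ (Fin d)) :
    character (a + b) ξ = character a ξ * character b ξ := by
  simp only [character, inner_add_left, ← Complex.exp_add]
  push_cast
  ring_nf

theorem fourierS_shift (a : EuclideanSpace ℝ (Fin d)) (η : 𝓢(EuclideanSpace ℝ (Fin d), ℂ)) :
    SchwartzMap.compSubConstCLM ℂ (-a) (fourierS d η) =
      fourierS d (SchwartzMap.smulLeftCLM ℂ (character a) η) := by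
  ext x
  rw [SchwartzMap.compSubConstCLM_apply, sub_neg_eq_add, fourierS_apply, fourierS_apply]
  refine integral_congr_ae (Eventually.of_forall fun ξ => ?_)
  simp only
  rw [SchwartzMap.smulLeftCLM_apply_apply (hasTemperateGrowth_character a), smul_eq_mul,
    ← mul_assoc, character, ← Complex.exp_add, inner_add_left]
  push_cast
  ring_nf

theorem fourierT_shift (a : EuclideanSpace ℝ (Fin d)) (u : 𝓢'(EuclideanSpace ℝ (Fin d), ℂ))
    (η : 𝓢(EuclideanSpace ℝ (Fin d), ℂ)) :
    fourierT (shift a u) η = fourierT u (SchwartzMap.smulLeftCLM ℂ (character a) η) := by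
  rw [fourierT_apply, fourierT_apply, ← fourierS_shift]
  rfl

theorem latticePt_add (k l : Fin d → ℤ) : latticePt (k + l) = latticePt k + latticePt l := by
  ext i
  simp [latticePt]

/-- The characters of `ℤ^d`, as a monoid homomorphism into the functions on `ℝ^d`. -/
noncomputable def characterHom (d : ℕ) :
    Multiplicative (Fin d → ℤ) →* (EuclideanSpace ℝ (Fin d) → ℂ) where
  toFun k := character (latticePt k.toAdd)
  map_one' := by
    funext ξ
    have : latticePt (0 : Fin d → ℤ) = 0 := by ext i; simp [latticePt]
    simp [character, this]
  map_mul' k l := by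
    funext ξ
    rw [toAdd_mul, latticePt_add]
    exact character_add _ _ _

/-- The trigonometric polynomial `∑ c_k e^{-ik·ξ}`. -/
noncomputable def trigPoly (d : ℕ) :
    AddMonoidAlgebra ℂ (Fin d → ℤ) →ₐ[ℂ] (EuclideanSpace ℝ (Fin d) → ℂ) :=
  AddMonoidAlgebra.lift ℂ _ _ (characterHom d)

/-- The range of `trigPoly` is a subalgebra, so G^m is recognized as a trigonometric polynomial by
closure properties, without computing coefficients. -/
theorem character_mem_range (k : Fin d → ℤ) : character (latticePt k) ∈ (trigPoly d).range :=
  ⟨AddMonoidAlgebra.single k 1, by simp [trigPoly, characterHom]⟩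

theorem trigPoly_apply (c : AddMonoidAlgebra ℂ (Fin d → ℤ)) (ξ : EuclideanSpace ℝ (Fin d)) :
    trigPoly d c ξ = c.coeff.sum fun k a => a * character (latticePt k) ξ := by
  rw [trigPoly, AddMonoidAlgebra.lift_apply, Finsupp.sum, Finset.sum_apply]
  rfl

theorem inner_latticePt_single (i : Fin d) (n : ℤ) (ξ : EuclideanSpace ℝ (Fin d)) :
    (inner ℝ (latticePt (Pi.single i n)) ξ : ℝ) = n * ξ i := by
  rw [PiLp.inner_apply, Finset.sum_eq_single i]
  · simp [latticePt, mul_comm]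
  · intro j _ hj
    simp [latticePt, hj]
  · simp

theorem exp_mem_range (i : Fin d) :
    (fun ξ : EuclideanSpace ℝ (Fin d) => Complex.exp ((ξ i : ℂ) * Complex.I)) ∈
      (trigPoly d).range ∧
    (fun ξ : EuclideanSpace ℝ (Fin d) => Complex.exp (-(ξ i : ℂ) * Complex.I)) ∈
      (trigPoly d).range := by
  constructor
  · convert character_mem_range (Pi.single i (-1)) using 2 with ξ
    rw [character, inner_latticePt_single]
    push_cast
    ring_nf
  · convert character_mem_range (Pi.single i 1) using 2 with ξ
    rw [character, inner_latticePt_single]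
    push_cast
    ring_nf

theorem sin_mem_range (i : Fin d) :
    (fun ξ : EuclideanSpace ℝ (Fin d) => (Real.sin (ξ i) : ℂ)) ∈ (trigPoly d).range := by
  have h := (trigPoly d).range.smul_mem
    ((trigPoly d).range.sub_mem (exp_mem_range i).2 (exp_mem_range i).1) (Complex.I / 2)
  convert h using 2 with ξ
  rw [Complex.ofReal_sin, Complex.sin]
  simp only [Pi.smul_apply, Pi.sub_apply, smul_eq_mul]
  ring

theorem cos_mem_range (i : Fin d) :
    (fun ξ : EuclideanSpace ℝ (Fin d) => (Real.cos (ξ i) : ℂ)) ∈ (trigPoly d).range := by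
  have h := (trigPoly d).range.smul_mem
    ((trigPoly d).range.add_mem (exp_mem_range i).1 (exp_mem_range i).2) (1 / 2)
  convert h using 2 with ξ
  rw [Complex.ofReal_cos, Complex.cos]
  simp only [Pi.smul_apply, Pi.add_apply, smul_eq_mul]
  ring

/-- The half angles disappear through 4 sin²(x/2) = 2(1 − cos x), leaving integer frequencies only.
-/
theorem G_mem_range (Q : Matrix (Fin d) (Fin d) ℝ) :
    (fun ξ : EuclideanSpace ℝ (Fin d) => (G Q ξ.ofLp : ℂ)) ∈ (trigPoly d).range := by
  have h1 : ∑ i, ((2 * (Q ^ 2) i i : ℝ) : ℂ) • ((1 : EuclideanSpace ℝ (Fin d) → ℂ) -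
      fun ξ : EuclideanSpace ℝ (Fin d) => (Real.cos (ξ i) : ℂ)) ∈ (trigPoly d).range :=
    sum_mem fun i _ => Subalgebra.smul_mem _ (sub_mem (one_mem _) (cos_mem_range i)) _
  have h2 : ∑ i, ∑ j ∈ Finset.Ioi i, ((2 * (Q ^ 2) i j : ℝ) : ℂ) •
      ((fun ξ : EuclideanSpace ℝ (Fin d) => (Real.sin (ξ i) : ℂ)) *
        fun ξ : EuclideanSpace ℝ (Fin d) => (Real.sin (ξ j) : ℂ)) ∈ (trigPoly d).range :=
    sum_mem fun i _ => sum_mem fun j _ =>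
      Subalgebra.smul_mem _ (mul_mem (sin_mem_range i) (sin_mem_range j)) _
  convert add_mem h1 h2 using 1
  funext ξ
  have h3 : ∀ i, 4 * Real.sin (ξ i / 2) ^ 2 = 2 * (1 - Real.cos (ξ i)) := fun i => by
    rw [Real.sin_sq_eq_half_sub]
    ring_nf
  have h4 : G Q ξ.ofLp = ∑ i, 2 * (Q ^ 2) i i * (1 - Real.cos (ξ i)) +
      ∑ i, ∑ j ∈ Finset.Ioi i, 2 * (Q ^ 2) i j * (Real.sin (ξ i) * Real.sin (ξ j)) := by
    rw [G, Finset.mul_sum, Finset.mul_sum]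
    congr 1
    · refine Finset.sum_congr rfl fun i _ => ?_
      linear_combination (Q ^ 2) i i * h3 i
    · refine Finset.sum_congr rfl fun i _ => ?_
      rw [Finset.mul_sum]
      exact Finset.sum_congr rfl fun j _ => by ring
  rw [h4]
  simp [Finset.sum_apply]

theorem exists_G_pow_eq_sum (Q : Matrix (Fin d) (Fin d) ℝ) (m : ℕ) :
    ∃ c : (Fin d → ℤ) →₀ ℂ, ∀ ξ : EuclideanSpace ℝ (Fin d),
      (G Q ξ.ofLp : ℂ) ^ m = c.sum fun k a => a * character (latticePt k) ξ := by
  obtain ⟨c, hc⟩ := pow_mem (G_mem_range Q) m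
  exact ⟨c.coeff, fun ξ => (congrFun hc ξ).symm.trans (trigPoly_apply c ξ)⟩

end EllipticScaling

namespace EllipticScaling

open Filter
open scoped Topology

variable {d : ℕ} {A : Matrix (Fin d) (Fin d) ℤ} {Q : Matrix (Fin d) (Fin d) ℝ}

/-! ### Sums of shifts -/

/-- The trigonometric polynomial is moved onto the test function. The new test function serves every
u, including those whose transform is only a regularization. -/
theorem exists_fourierT_sum_shift (c : (Fin d → ℤ) →₀ ℂ)
    (η : 𝓢(EuclideanSpace ℝ (Fin d), ℂ)) :
    ∃ η' : 𝓢(EuclideanSpace ℝ (Fin d), ℂ),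
      (∀ ξ, η' ξ = (c.sum fun k a => a * character (latticePt k) ξ) * η ξ) ∧
      ∀ u : 𝓢'(EuclideanSpace ℝ (Fin d), ℂ),
        fourierT (c.sum fun k a => a • shift (latticePt k) u) η = fourierT u η' := by
  refine ⟨∑ k ∈ c.support, c k • SchwartzMap.smulLeftCLM ℂ (character (latticePt k)) η,
    fun ξ => ?_, fun u => ?_⟩
  · rw [_root_.sum_apply, Finsupp.sum, Finset.sum_mul]
    refine Finset.sum_congr rfl fun k _ => ?_
    rw [smul_apply, SchwartzMap.smulLeftCLM_apply_apply (hasTemperateGrowth_character _),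
      smul_eq_mul, smul_eq_mul, mul_assoc]
  · have h : fourierT (c.sum fun k a => a • shift (latticePt k) u) η =
        ∑ k ∈ c.support, c k • fourierT (shift (latticePt k) u) η := by
      simp [fourierT_apply, Finsupp.sum]
    rw [h, map_sum]
    refine Finset.sum_congr rfl fun k _ => ?_
    rw [fourierT_shift, map_smul]

theorem fourierT_delta_zero (η : 𝓢(EuclideanSpace ℝ (Fin d), ℂ)) :
    fourierT (TemperedDistribution.delta 0) η = ∫ ξ, η ξ := by
  rw [fourierT_apply, TemperedDistribution.delta_apply, fourierS_apply]
  simp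

theorem shift_delta_zero (a : EuclideanSpace ℝ (Fin d)) :
    shift a (TemperedDistribution.delta 0) = TemperedDistribution.delta a := by
  ext η
  change SchwartzMap.compSubConstCLM ℂ (-a) η 0 = η a
  simp

theorem isVanishingOn_sum_delta (c : (Fin d → ℤ) →₀ ℂ) :
    Distribution.IsVanishingOn
      (c.sum fun k a => a • shift (latticePt k) (TemperedDistribution.delta 0) :
        𝓢'(EuclideanSpace ℝ (Fin d), ℂ))
      (Set.range (latticePt (d := d)))ᶜ := by
  intro η hη
  have h : ∀ k, η (latticePt k) = 0 := fun k =>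
    image_eq_zero_of_notMem_tsupport fun hk => hη hk ⟨k, rfl⟩
  simp [Finsupp.sum, shift_delta_zero, h]

/-! ### The functions `(M / P)^m` and `φ̂^m` -/

theorem measurable_ofLp : Measurable (WithLp.ofLp : EuclideanSpace ℝ (Fin d) → Fin d → ℝ) :=
  (PiLp.continuous_ofLp 2 _).measurable

theorem exists_isGreenFunction (hd : 1 ≤ d) (hA : 1 < absDet A) (hQ : IsSimilarityFactor A Q)
    (m : ℕ) : ∃ ρ, IsGreenFunction A Q m ρ := by
  obtain ⟨C, hC, k, hM⟩ := exists_M_le_norm hd hA hQ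
  obtain ⟨c, hc, hP⟩ := exists_norm_sq_le_P hQ.1
  -- The lower bound of P by c‖ξ‖² gives a singularity of order 2m, and the growth of M gives the
  -- exponent k m.
  refine exists_hasFourierTransform (N := 2 * m) (K := k * m) (C := (C / c) ^ m) (by positivity)
    ?_ (Eventually.of_forall fun ξ => ?_)
  · refine Measurable.aestronglyMeasurable ?_
    exact (Complex.measurable_ofReal.comp (((measurable_M hd hA hQ).div
      continuous_P.measurable).comp measurable_ofLp)).pow_const m
  · have h1 : 0 ≤ M A Q ξ.ofLp / P Q ξ.ofLp :=
      div_nonneg (M_pos hd hA hQ _).le (P_nonneg hQ.1 _)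
    have h2 : ‖ξ‖ ^ 2 * (M A Q ξ.ofLp / P Q ξ.ofLp) ≤ C / c * (1 + ‖ξ‖) ^ k := by
      rcases (P_nonneg hQ.1 ξ.ofLp).eq_or_lt with h0 | h0
      -- This is the origin, where the quotient M / P is 0 by convention.
      · rw [← h0, div_zero, mul_zero]
        positivity
      · rw [mul_div_assoc', div_le_iff₀ h0]
        calc ‖ξ‖ ^ 2 * M A Q ξ.ofLp ≤ (P Q ξ.ofLp / c) * (C * (1 + ‖ξ‖) ^ k) := by
              refine mul_le_mul ?_ (hM ξ) (M_pos hd hA hQ _).le (by positivity)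
              rw [le_div_iff₀ hc, mul_comm]
              exact hP ξ
          _ = _ := by ring
    rw [norm_pow, Complex.norm_real, Real.norm_of_nonneg h1, pow_mul, ← mul_pow, pow_mul,
      ← mul_pow]
    exact pow_le_pow_left₀ (by positivity) h2 m

/-- In φ̂ = M · (G/P) the quotient G/P is bounded, so no singularity remains at the origin. -/
theorem exists_norm_phiHat_pow_le (hd : 1 ≤ d) (hA : 1 < absDet A) (hQ : IsSimilarityFactor A Q)
    (m : ℕ) : ∃ C, 0 ≤ C ∧ ∃ k : ℕ, ∀ᵐ ξ : EuclideanSpace ℝ (Fin d),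
      ‖((phiHat A Q ξ.ofLp : ℝ) : ℂ) ^ m‖ ≤ C * (1 + ‖ξ‖) ^ k := by
  obtain ⟨C, hC, k, hM⟩ := exists_M_le_norm hd hA hQ
  obtain ⟨K, hK, hG⟩ := exists_G_le_P hQ.1
  refine ⟨(K * C) ^ m, by positivity, k * m, ?_⟩
  filter_upwards [ae_G_ne_zero hd hQ.1] with ξ hξ
  have hM0 := M_pos hd hA hQ ξ.ofLp
  have h1 := phiHat_eq hd hA hQ hξ
  have h2 : 0 ≤ phiHat A Q ξ.ofLp := by
    rw [h1]
    exact mul_nonneg (div_nonneg hM0.le (P_nonneg hQ.1 _)) (G_nonneg hQ.1 _)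
  rw [norm_pow, Complex.norm_real, Real.norm_of_nonneg h2, pow_mul, ← mul_pow]
  refine pow_le_pow_left₀ h2 ?_ m
  have hP : 0 < P Q ξ.ofLp :=
    pos_of_mul_pos_right (((G_nonneg hQ.1 _).lt_of_ne' hξ).trans_le (hG _)) hK.le
  rw [h1, div_mul_eq_mul_div, div_le_iff₀ hP]
  calc M A Q ξ.ofLp * G Q ξ.ofLp ≤ C * (1 + ‖ξ‖) ^ k * (K * P Q ξ.ofLp) :=
        mul_le_mul (hM ξ) (hG _) (G_nonneg hQ.1 _) (by positivity)
    _ = _ := by ring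

theorem aestronglyMeasurable_phiHat_pow (hd : 1 ≤ d) (hA : 1 < absDet A)
    (hQ : IsSimilarityFactor A Q) (m : ℕ) :
    AEStronglyMeasurable (fun ξ : EuclideanSpace ℝ (Fin d) =>
      ((phiHat A Q ξ.ofLp : ℝ) : ℂ) ^ m) volume :=
  ((Complex.measurable_ofReal.comp
    ((measurable_phiHat hd hA hQ).comp measurable_ofLp)).pow_const m).aestronglyMeasurable

theorem integrable_phiHat_pow_mul (hd : 1 ≤ d) (hA : 1 < absDet A) (hQ : IsSimilarityFactor A Q)
    (m : ℕ) (η : 𝓢(EuclideanSpace ℝ (Fin d), ℂ)) :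
    Integrable fun ξ => ((phiHat A Q ξ.ofLp : ℝ) : ℂ) ^ m * η ξ := by
  obtain ⟨C, hC, k, h⟩ := exists_norm_phiHat_pow_le hd hA hQ m
  exact integrable_mul_schwartz hC (aestronglyMeasurable_phiHat_pow hd hA hQ m) h η

theorem existsUnique_isEllipticScalingFunction (hd : 1 ≤ d) (hA : 1 < absDet A)
    (hQ : IsSimilarityFactor A Q) (m : ℕ) :
    ∃! φ : 𝓢'(EuclideanSpace ℝ (Fin d), ℂ), IsEllipticScalingFunction A Q m φ := by
  obtain ⟨C, hC, k, h⟩ := exists_norm_phiHat_pow_le hd hA hQ m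
  obtain ⟨φ, hφ⟩ := exists_hasFourierTransform (N := 0) hC
    (aestronglyMeasurable_phiHat_pow hd hA hQ m) (by simpa only [pow_zero, one_mul] using h)
  exact ⟨φ, hφ, fun ψ hψ =>
    HasFourierTransform.unique hψ hφ (integrable_phiHat_pow_mul hd hA hQ m)⟩

theorem P_ne_zero_of_G (hQ : Q.PosDef) {ξ : Fin d → ℝ} (h : G Q ξ ≠ 0) : P Q ξ ≠ 0 := by
  intro h0
  obtain ⟨K, -, hG⟩ := exists_G_le_P hQ
  have := hG ξ
  rw [h0, mul_zero] at this
  exact h (le_antisymm this (G_nonneg hQ ξ))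

/-- `(Δ♯)^m ρ = δ`. -/
theorem IsGreenFunction.isDeltaSharpPow (hd : 1 ≤ d) (hA : 1 < absDet A)
    (hQ : IsSimilarityFactor A Q) {m : ℕ} {ρ : 𝓢'(EuclideanSpace ℝ (Fin d), ℂ)}
    (hρ : IsGreenFunction A Q m ρ) :
    IsDeltaSharpPow A Q m ρ (TemperedDistribution.delta 0) := by
  refine ⟨_, hρ, ?_⟩
  have h1 : HasFourierTransform (TemperedDistribution.delta (0 : EuclideanSpace ℝ (Fin d)))
      fun _ => 1 := by
    refine ⟨(locallyIntegrable_const 1).locallyIntegrableOn _, fun η _ => ?_⟩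
    rw [fourierT_delta_zero]
    simp
  refine h1.congr_ae ?_
  filter_upwards [ae_G_ne_zero hd hQ.1] with ξ hξ
  have hP := P_ne_zero_of_G hQ.1 hξ
  have hM := (M_pos hd hA hQ ξ.ofLp).ne'
  rw [deltaSharpSymbol, ← mul_pow, ← Complex.ofReal_mul, div_mul_div_comm, mul_comm (M A Q _),
    div_self (mul_ne_zero hP hM), Complex.ofReal_one, one_pow]

/-- The elliptic scaling function is a combination of shifts of any Green function. -/
theorem IsEllipticScalingFunction.eq_sum_shift (hd : 1 ≤ d) (hA : 1 < absDet A)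
    (hQ : IsSimilarityFactor A Q) {m : ℕ} {φ ρ : 𝓢'(EuclideanSpace ℝ (Fin d), ℂ)}
    (hφ : IsEllipticScalingFunction A Q m φ) (hρ : IsGreenFunction A Q m ρ)
    {c : (Fin d → ℤ) →₀ ℂ} (hc : ∀ ξ : EuclideanSpace ℝ (Fin d),
      (G Q ξ.ofLp : ℂ) ^ m = c.sum fun k a => a * character (latticePt k) ξ) :
    φ = c.sum fun k a => a • shift (latticePt k) ρ := by
  refine fourierT_injective ?_
  ext η
  obtain ⟨η', hη', h⟩ := exists_fourierT_sum_shift c η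
  have hint := integrable_phiHat_pow_mul hd hA hQ m η
  have hae : (fun ξ => ((phiHat A Q ξ.ofLp : ℝ) : ℂ) ^ m * η ξ) =ᵐ[volume]
      fun ξ => ((M A Q ξ.ofLp / P Q ξ.ofLp : ℝ) : ℂ) ^ m * η' ξ := by
    filter_upwards [ae_G_ne_zero hd hQ.1] with ξ hξ
    rw [hη', ← hc, phiHat_eq hd hA hQ hξ, Complex.ofReal_mul, mul_pow, mul_assoc]
  -- The integral of (M/P)^m η' converges because the integrand is φ̂^m η almost everywhere. Hence
  -- every regularization ρ takes the same value on η'.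
  rw [h, hφ.2 η hint, hρ.2 η' (hint.congr hae), integral_congr_ae hae]

/-! ### The image of φ^m under (Δ♯)^m and its Fourier transform G^m. -/

theorem integrable_G_pow_mul (hQ : Q.PosDef) (m : ℕ) (η : 𝓢(EuclideanSpace ℝ (Fin d), ℂ)) :
    Integrable fun ξ => (G Q ξ.ofLp : ℂ) ^ m * η ξ := by
  obtain ⟨K, hK, hG⟩ := exists_G_le_const hQ
  refine integrable_mul_schwartz (K := 0) (C := K ^ m) (by positivity)
    ((Complex.measurable_ofReal.comp (contDiff_G.continuous.measurable.comp
      measurable_ofLp)).pow_const m).aestronglyMeasurable (Eventually.of_forall fun ξ => ?_) η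
  change ‖(G Q ξ.ofLp : ℂ) ^ m‖ ≤ _
  rw [norm_pow, Complex.norm_real, Real.norm_of_nonneg (G_nonneg hQ _), pow_zero, mul_one]
  exact pow_le_pow_left₀ (G_nonneg hQ _) (hG _) m

theorem hasFourierTransform_sum_shift_delta {m : ℕ} {c : (Fin d → ℤ) →₀ ℂ}
    (hc : ∀ ξ : EuclideanSpace ℝ (Fin d),
      (G Q ξ.ofLp : ℂ) ^ m = c.sum fun k a => a * character (latticePt k) ξ) :
    HasFourierTransform
      (c.sum fun k a => a • shift (latticePt k)
        (TemperedDistribution.delta (0 : EuclideanSpace ℝ (Fin d))))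
      fun ξ => (G Q ξ.ofLp : ℂ) ^ m := by
  constructor
  · refine (Continuous.locallyIntegrable ?_).locallyIntegrableOn _
    exact (Complex.continuous_ofReal.comp (contDiff_G.continuous.comp
      (PiLp.continuous_ofLp 2 _))).pow m
  · intro η _
    obtain ⟨η', hη', h⟩ := exists_fourierT_sum_shift c η
    rw [h, fourierT_delta_zero]
    simp only [hη', hc]

theorem symbol_mul_phiHat_ae_eq (hd : 1 ≤ d) (hA : 1 < absDet A) (hQ : IsSimilarityFactor A Q)
    (m : ℕ) : (fun ξ : EuclideanSpace ℝ (Fin d) =>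
      deltaSharpSymbol A Q ξ ^ m * ((phiHat A Q ξ.ofLp : ℝ) : ℂ) ^ m) =ᵐ[volume]
      fun ξ => (G Q ξ.ofLp : ℂ) ^ m := by
  filter_upwards [ae_G_ne_zero hd hQ.1] with ξ hξ
  have hP := P_ne_zero_of_G hQ.1 hξ
  have hM := (M_pos hd hA hQ ξ.ofLp).ne'
  rw [deltaSharpSymbol, ← mul_pow, ← Complex.ofReal_mul, phiHat_eq hd hA hQ hξ]
  congr 2
  field_simp

/-- `v = (Δ♯)^m φ^m` has the Fourier transform `G^m`, whatever function represents `φ̂^m`. -/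
theorem IsDeltaSharpPow.hasFourierTransform (hd : 1 ≤ d) (hA : 1 < absDet A)
    (hQ : IsSimilarityFactor A Q) {m : ℕ} {φ v : 𝓢'(EuclideanSpace ℝ (Fin d), ℂ)}
    (hφ : IsEllipticScalingFunction A Q m φ) (hv : IsDeltaSharpPow A Q m φ v) :
    HasFourierTransform v fun ξ => (G Q ξ.ofLp : ℂ) ^ m := by
  obtain ⟨f, hf, hfv⟩ := hv
  refine hfv.congr_ae (EventuallyEq.trans ?_ (symbol_mul_phiHat_ae_eq hd hA hQ m))
  -- The function f representing the transform of φ is arbitrary in `IsImageUnderSymbol`; it agrees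
  -- with φ̂^m almost everywhere.
  filter_upwards [hf.ae_eq hd hφ] with ξ hξ
  rw [hξ]

end EllipticScaling

theorem mainTheorem9 {d : ℕ} (hd : 1 ≤ d) (A : Matrix (Fin d) (Fin d) ℤ)
    (hdil : IsDilation A) (hiso : IsIsotropic A)
    (Q : Matrix (Fin d) (Fin d) ℝ) (hQ : IsSimilarityFactor A Q) (m : ℕ) (hm : 1 ≤ m) :
    (∃! φ : 𝓢'(EuclideanSpace ℝ (Fin d), ℂ), IsEllipticScalingFunction A Q m φ) ∧
    (∃ ρ : 𝓢'(EuclideanSpace ℝ (Fin d), ℂ), IsGreenFunction A Q m ρ) ∧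
    (∀ ρ : 𝓢'(EuclideanSpace ℝ (Fin d), ℂ), IsGreenFunction A Q m ρ →
      IsDeltaSharpPow A Q m ρ (TemperedDistribution.delta 0)) ∧
    ∀ φ : 𝓢'(EuclideanSpace ℝ (Fin d), ℂ), IsEllipticScalingFunction A Q m φ →
      (∃ c : (Fin d → ℤ) →₀ ℂ, ∀ ρ : 𝓢'(EuclideanSpace ℝ (Fin d), ℂ), IsGreenFunction A Q m ρ →
        φ = c.sum fun k a => a • shift (latticePt k) ρ) ∧
      (∃! v : 𝓢'(EuclideanSpace ℝ (Fin d), ℂ), IsDeltaSharpPow A Q m φ v) ∧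
      ∀ v : 𝓢'(EuclideanSpace ℝ (Fin d), ℂ), IsDeltaSharpPow A Q m φ v →
        Distribution.IsVanishingOn v (Set.range (latticePt (d := d)))ᶜ := by
  have hA := one_lt_absDet hd hdil
  obtain ⟨c, hc⟩ := exists_G_pow_eq_sum Q m
  have hv := hasFourierTransform_sum_shift_delta hc
  refine ⟨existsUnique_isEllipticScalingFunction hd hA hQ m, exists_isGreenFunction hd hA hQ m,
    fun ρ hρ => hρ.isDeltaSharpPow hd hA hQ, fun φ hφ =>
    ⟨⟨c, fun ρ hρ => hφ.eq_sum_shift hd hA hQ hρ hc⟩, ?_⟩⟩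
  -- Every image has the transform G^m, which is bounded and so determines the distribution: it is
  -- the combination of lattice deltas with the same coefficients c as for φ.
  have huniq : ∀ v, IsDeltaSharpPow A Q m φ v → v = c.sum fun k a => a • shift (latticePt k)
      (TemperedDistribution.delta (0 : EuclideanSpace ℝ (Fin d))) := fun v h =>
    (IsDeltaSharpPow.hasFourierTransform hd hA hQ hφ h).unique hv
      (integrable_G_pow_mul hQ.1 m)
  refine ⟨⟨_, ⟨_, hφ, hv.congr_ae (symbol_mul_phiHat_ae_eq hd hA hQ m).symm⟩, huniq⟩,
    fun v h => ?_⟩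
  rw [huniq v h]
  exact isVanishingOn_sum_delta c
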